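/- Let $\mathbb{F}$ be an algebraically closed field of characteristic $p>3$. Let $\mathcal{O}(2;\underline{1})=\mathbb{F}[x,y]/(x^p,y^p)$ and let $W(2;\underline{1})=\mathrm{Der}_{\mathbb{F}}\,\mathcal{O}(2;\underline{1})$ be the Jacobson–Witt algebra, a restricted Lie algebra whose $[p]$-map is the $p$-th power of derivations. Let $$H(2;\underline{1};\Phi(\tau))=\{D\in W(2;\underline{1})\mid D\big((1+x^{p-1}y^{p-1})\,dx\wedge dy\big)=0\},$$ where $D$ acts on differential $2$-forms by the Lie derivative, and let $H(2;\underline{1};\Phi(\tau))^{(1)}$ be its derived subalgebra. Put $\Gamma=x^{p-1}\partial_y$, $\Theta=-y^{p-1}\partial_x$, and $$L=H(2;\underline{1};\Phi(\tau))^{(1)}\oplus\mathbb{F}\Gamma\oplus\mathbb{F}\Theta ,$$ a $p$-subalgebra of $W(2;\underline{1})$ (the minimal $p$-envelope of $H(2;\underline{1};\Phi(\tau))^{(1)}$ in $W(2;\underline{1})$). Give $W(2;\underline{1})$ its natural grading, in which $f\partial_x+g\partial_y$ has degree $d$ if $f$ and $g$ are homogeneous of degree $d+1$, and for $n\in\{0,1\}$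 let $L_{(n)}$ be the set of the elements of $L$ all of whose homogeneous components have degree at least $n$. Taking the matrix of the degree $0$ component with respect to the basis $x,y$ of $\mathbb{F}x\oplus\mathbb{F}y$ induces an isomorphism $L_{(0)}/L_{(1)}\cong\mathfrak{sl}_2(\mathbb{F})$. For $\lambda\in\{0,\dots,p-1\}$ let $V(\lambda)$ be the irreducible restricted $\mathfrak{sl}_2(\mathbb{F})$-module of highest weight $\lambda$ (of dimension $\lambda+1$), viewed as an $L_{(0)}$-module through this isomorphism. For a restricted Lie algebra $G$, let $u(G)=U(G)/(z^p-z^{[p]}\mid z\in G)$ be its restricted universal enveloping algebra. Then the induced restricted $L$-module $$M(\lambda)=\mathrm{Ind}_{L_{(0)}}^{L}(V(\lambda),0)=u(L)\otimes_{u(L_{(0)})}V(\lambda)$$ is irreducible for every $\lambda\in\{2,\dots,p-1\}$. -/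

import Mathlib

open scoped TensorProduct

set_option linter.unusedSectionVars false

attribute [local instance 100] LieRing.ofAssociativeRing

namespace HamTau

section TruncatedPolynomials

/-- The ideal `(x ^ p, y ^ p)` of `F[x, y]`. -/
noncomputable def truncIdeal (F : Type*) [Field F] (p : ℕ) : Ideal (MvPolynomial (Fin 2) F) :=
  Ideal.span (Set.range fun i : Fin 2 => (MvPolynomial.X i : MvPolynomial (Fin 2) F) ^ p)

/-- The truncated polynomial algebra `O(2;1) = F[x, y] / (x ^ p, y ^ p)`. -/
def TruncPoly (F : Type*) [Field F] (p : ℕ) : Type _ :=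
  MvPolynomial (Fin 2) F ⧸ truncIdeal F p

noncomputable instance (F : Type*) [Field F] (p : ℕ) : CommRing (TruncPoly F p) :=
  inferInstanceAs (CommRing (MvPolynomial (Fin 2) F ⧸ truncIdeal F p))

noncomputable instance (F : Type*) [Field F] (p : ℕ) : Algebra F (TruncPoly F p) :=
  inferInstanceAs (Algebra F (MvPolynomial (Fin 2) F ⧸ truncIdeal F p))

/-- The quotient map `F[x, y] → O(2;1)`. -/
noncomputable def toTrunc (F : Type*) [Field F] (p : ℕ) :
    MvPolynomial (Fin 2) F →ₐ[F] TruncPoly F p :=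
  Ideal.Quotient.mkₐ F (truncIdeal F p)

/-- The Jacobson-Witt algebra `W(2;1)` of all derivations of `O(2;1)`. -/
abbrev Witt (F : Type*) [Field F] (p : ℕ) : Type _ :=
  Derivation F (TruncPoly F p) (TruncPoly F p)

/-- The generators of `O(2;1)`: `gen F p 0` is `x` and `gen F p 1` is `y`. -/
noncomputable def gen (F : Type*) [Field F] (p : ℕ) (i : Fin 2) : TruncPoly F p :=
  toTrunc F p (MvPolynomial.X i)

variable {F : Type*} [Field F] {p : ℕ}

theorem toTrunc_surjective : Function.Surjective (toTrunc F p) :=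
  Ideal.Quotient.mkₐ_surjective F _

theorem toTrunc_eq_zero {f : MvPolynomial (Fin 2) F} :
    toTrunc F p f = 0 ↔ f ∈ truncIdeal F p :=
  Ideal.Quotient.eq_zero_iff_mem

theorem gen_pow (i : Fin 2) : gen F p i ^ p = 0 := by
  rw [gen, ← map_pow, toTrunc_eq_zero]
  exact Ideal.subset_span ⟨i, rfl⟩

theorem pderiv_mem [CharP F p] (i : Fin 2) (f : MvPolynomial (Fin 2) F)
    (hf : f ∈ truncIdeal F p) : MvPolynomial.pderiv i f ∈ truncIdeal F p := by
  induction hf using Submodule.span_induction with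
  | mem f hf =>
    obtain ⟨j, rfl⟩ := hf
    simp [Derivation.leibniz_pow]
  | zero => simp
  | add f g _ _ hf hg => rw [map_add]; exact add_mem hf hg
  | smul a f hf' hf =>
    rw [smul_eq_mul, Derivation.leibniz, smul_eq_mul, smul_eq_mul]
    exact add_mem (Ideal.mul_mem_left _ _ hf) (Ideal.mul_mem_right _ _ hf')

theorem mk_pderiv_eq_zero [CharP F p] (i : Fin 2) (f : MvPolynomial (Fin 2) F)
    (hf : toTrunc F p f = 0) :
    toTrunc F p (MvPolynomial.pderiv i f) = 0 := by
  rw [toTrunc_eq_zero] at hf ⊢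
  exact pderiv_mem i f hf

/-- The partial derivative `∂ / ∂x` (`i = 0`) or `∂ / ∂y` (`i = 1`) of `O(2;1)`. -/
noncomputable def partialD (F : Type*) [Field F] (p : ℕ) [CharP F p] (i : Fin 2) : Witt F p :=
  Derivation.liftOfSurjective (f := toTrunc F p) toTrunc_surjective
    (d := MvPolynomial.pderiv i) (mk_pderiv_eq_zero i)

theorem partialD_mk [CharP F p] (i : Fin 2) (f : MvPolynomial (Fin 2) F) :
    partialD F p i (toTrunc F p f) =
      toTrunc F p (MvPolynomial.pderiv i f) :=
  Derivation.liftOfSurjective_apply toTrunc_surjective (mk_pderiv_eq_zero i) f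

theorem partialD_gen [CharP F p] (i j : Fin 2) :
    partialD F p i (gen F p j) = if i = j then 1 else 0 := by
  rw [gen, partialD_mk, MvPolynomial.pderiv_X, Pi.single_apply]
  by_cases h : i = j <;> simp [h, eq_comm]

/-- Derivations of `O(2;1)` are determined by their values on the two generators. -/
theorem witt_ext {D E : Witt F p} (h : ∀ i, D (gen F p i) = E (gen F p i)) : D = E := by
  refine Derivation.ext fun f => ?_
  obtain ⟨f, rfl⟩ := toTrunc_surjective f
  induction f using MvPolynomial.induction_on with
  | C a =>
    rw [← MvPolynomial.algebraMap_eq, AlgHom.commutes, Derivation.map_algebraMap,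
      Derivation.map_algebraMap]
  | add f g hf hg => simp only [map_add, hf, hg]
  | mul_X f i hf =>
    have hi := h i
    unfold gen at hi
    rw [map_mul, Derivation.leibniz, Derivation.leibniz, hf, hi]

theorem witt_apply [CharP F p] (D : Witt F p) (f : TruncPoly F p) :
    D f = D (gen F p 0) * partialD F p 0 f + D (gen F p 1) * partialD F p 1 f := by
  have : D = D (gen F p 0) • partialD F p 0 + D (gen F p 1) • partialD F p 1 :=
    witt_ext fun i => by fin_cases i <;> simp [partialD_gen]
  conv_lhs => rw [this]
  simp

theorem partialD_comm [CharP F p] (i j : Fin 2) (f : TruncPoly F p) :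
    partialD F p i (partialD F p j f) = partialD F p j (partialD F p i f) := by
  have : ⁅partialD F p i, partialD F p j⁆ = 0 :=
    witt_ext fun k => by
      rw [Derivation.commutator_apply, partialD_gen, partialD_gen]
      split_ifs <;> simp
  have h := congrArg (fun D : Witt F p => D f) this
  simpa [Derivation.commutator_apply, sub_eq_zero] using h

/-- The augmentation `O(2;1) → F`, that is, evaluation at the origin (the constant term). -/
noncomputable def aug (F : Type*) [Field F] (p : ℕ) [Fact p.Prime] : TruncPoly F p →ₐ[F] F :=
  Ideal.Quotient.liftₐ (truncIdeal F p) (MvPolynomial.aeval fun _ => (0 : F)) (by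
    intro f hf
    have h : truncIdeal F p ≤ RingHom.ker (MvPolynomial.aeval fun _ : Fin 2 => (0 : F)) := by
      refine Ideal.span_le.2 ?_
      rintro _ ⟨i, rfl⟩
      simp [(Fact.out : p.Prime).ne_zero]
    exact h hf)

theorem aug_gen [Fact p.Prime] (i : Fin 2) : aug F p (gen F p i) = 0 := by
  change (MvPolynomial.aeval fun _ => (0 : F)) (MvPolynomial.X i) = 0
  simp

instance [Fact p.Prime] : Nontrivial (TruncPoly F p) := (aug F p).toRingHom.domain_nontrivial

end TruncatedPolynomials

section PMap

variable {F : Type*} [Field F] {p : ℕ} [Fact p.Prime] [CharP F p]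

theorem ad_pow_char {A : Type*} [Ring A] [Algebra F A] (a b : A) :
    ((LieAlgebra.ad F A a) ^ p) b = a ^ p * b - b * a ^ p := by
  nontriviality A
  have : CharP (Module.End F A) p := charP_of_injective_algebraMap (algebraMap F _).injective p
  rw [LieAlgebra.ad_eq_lmul_left_sub_lmul_right, Pi.sub_apply,
    sub_pow_char_of_commute p (LinearMap.commute_mulLeft_right a a), LinearMap.pow_mulLeft,
    LinearMap.pow_mulRight]
  rfl

/-- The `[p]`-map of the Witt algebra: the `p`-th power of a derivation, as an operator, is again
a derivation. -/
noncomputable def wittP (D : Witt F p) : Witt F p :=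
  Derivation.mk' ((D : Module.End F (TruncPoly F p)) ^ p) (by
    intro a b
    have key : ∀ (n : ℕ), ((LieAlgebra.ad F _ (D : Module.End F (TruncPoly F p))) ^ n)
        (LinearMap.mulLeft F a) =
          LinearMap.mulLeft F (((D : Module.End F (TruncPoly F p)) ^ n) a) := by
      intro n
      induction n with
      | zero => simp
      | succ n ih =>
        rw [pow_succ', Module.End.mul_apply, ih, pow_succ']
        refine LinearMap.ext fun c => ?_
        simp [LieRing.of_associative_ring_bracket]
        ring
    have h := key p
    rw [ad_pow_char] at h
    have h2 := congrArg (fun T : Module.End F (TruncPoly F p) => T b) h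
    simp only [LinearMap.sub_apply, Module.End.mul_apply, LinearMap.mulLeft_apply] at h2
    rw [smul_eq_mul, smul_eq_mul, mul_comm b, ← h2]
    ring)

theorem wittP_apply (D : Witt F p) (f : TruncPoly F p) :
    wittP D f = ((D : Module.End F (TruncPoly F p)) ^ p) f := rfl

theorem wittP_lie (D E : Witt F p) : ⁅wittP D, E⁆ = ((LieAlgebra.ad F (Witt F p) D) ^ p) E := by
  have key : ∀ n : ℕ, ((((LieAlgebra.ad F (Witt F p) D) ^ n) E : Witt F p) :
      Module.End F (TruncPoly F p)) =
      ((LieAlgebra.ad F _ (D : Module.End F (TruncPoly F p))) ^ n) E := by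
    intro n
    induction n with
    | zero => simp
    | succ n ih =>
      rw [pow_succ', Module.End.mul_apply, pow_succ', Module.End.mul_apply, ← ih,
        LieAlgebra.ad_apply, LieAlgebra.ad_apply, Derivation.commutator_coe_linear_map]
  refine Derivation.ext fun f => ?_
  have h := congrArg (fun T : Module.End F (TruncPoly F p) => T f) (key p)
  rw [ad_pow_char] at h
  exact h.symm

end PMap

section Hamiltonian

/-- `F`-bilinear maps `W(2;1) × W(2;1) → O(2;1)`, a space that contains the differential
`2`-forms. -/
abbrev BiForm (F : Type*) [Field F] (p : ℕ) : Type _ :=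
  Witt F p →ₗ[F] Witt F p →ₗ[F] TruncPoly F p

variable {F : Type*} [Field F] {p : ℕ}

/-- The differential `2`-form `u dx ∧ dy`. -/
noncomputable def areaForm (u : TruncPoly F p) : BiForm F p :=
  LinearMap.mk₂ F
    (fun A B => u * (A (gen F p 0) * B (gen F p 1) - A (gen F p 1) * B (gen F p 0)))
    (fun A A' B => by simp; ring) (fun c A B => by simp [← smul_sub])
    (fun A B B' => by simp; ring) (fun c A B => by simp [← smul_sub])

theorem areaForm_apply (u : TruncPoly F p) (A B : Witt F p) :
    areaForm u A B =
      u * (A (gen F p 0) * B (gen F p 1) - A (gen F p 1) * B (gen F p 0)) := rfl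

/-- The action of a derivation on forms (the Lie derivative):
`(D ω)(A, B) = D (ω (A, B)) - ω ([D, A], B) - ω (A, [D, B])`. -/
noncomputable def lieDer (D : Witt F p) (ω : BiForm F p) : BiForm F p :=
  ω.compr₂ (D : TruncPoly F p →ₗ[F] TruncPoly F p) - ω ∘ₗ LieAlgebra.ad F (Witt F p) D -
    ω.compl₂ (LieAlgebra.ad F (Witt F p) D)

theorem lieDer_apply (D : Witt F p) (ω : BiForm F p) (A B : Witt F p) :
    lieDer D ω A B = D (ω A B) - ω ⁅D, A⁆ B - ω A ⁅D, B⁆ := rfl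

theorem lieDer_eq_zero_iff (D : Witt F p) (ω : BiForm F p) :
    lieDer D ω = 0 ↔ ∀ A B, D (ω A B) = ω ⁅D, A⁆ B + ω A ⁅D, B⁆ := by
  constructor
  · intro h A B
    have := congrArg (fun η : BiForm F p => η A B) h
    simp only [lieDer_apply, LinearMap.zero_apply] at this
    linear_combination this
  · intro h
    refine LinearMap.ext fun A => LinearMap.ext fun B => ?_
    rw [lieDer_apply, h A B]
    simp

/-- The Lie algebra of the derivations that annihilate a given form. -/
noncomputable def formStabilizer (ω : BiForm F p) : LieSubalgebra F (Witt F p) where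
  carrier := {D | lieDer D ω = 0}
  zero_mem' := by simp [lieDer_eq_zero_iff]
  add_mem' := by
    intro D E hD hE
    simp only [Set.mem_ofPred_eq, lieDer_eq_zero_iff] at *
    intro A B
    simp [hD A B, hE A B]
    ring
  smul_mem' := by
    intro c D hD
    simp only [Set.mem_ofPred_eq, lieDer_eq_zero_iff] at *
    intro A B
    simp [hD A B]
  lie_mem' := by
    intro D E hD hE
    simp only [Set.mem_ofPred_eq, lieDer_eq_zero_iff] at *
    intro A B
    rw [Derivation.commutator_apply, hE A B, hD A B, map_add, map_add, hD, hD, hE, hE,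
      lie_lie, lie_lie]
    simp only [map_sub, LinearMap.sub_apply]
    ring

theorem mem_formStabilizer {ω : BiForm F p} {D : Witt F p} :
    D ∈ formStabilizer ω ↔ ∀ A B, D (ω A B) = ω ⁅D, A⁆ B + ω A ⁅D, B⁆ :=
  lieDer_eq_zero_iff D ω

theorem sub_sub_pow_char [Fact p.Prime] {R : Type*} [Ring R] [CharP R p] {a b c : R}
    (hab : Commute a b) (hac : Commute a c) (hbc : Commute b c) :
    (a - b - c) ^ p = a ^ p - b ^ p - c ^ p := by
  rw [sub_pow_char_of_commute p (hac.sub_left hbc), sub_pow_char_of_commute p hab]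

theorem wittP_mem_formStabilizer [Fact p.Prime] [CharP F p] {ω : BiForm F p} {D : Witt F p}
    (hD : D ∈ formStabilizer ω) : wittP D ∈ formStabilizer ω := by
  let ad := LieAlgebra.ad F (Witt F p) D
  let E1 : Module.End F (BiForm F p) :=
    { toFun := fun η => η.compr₂ (D : TruncPoly F p →ₗ[F] TruncPoly F p)
      map_add' := fun η ζ => by ext; simp
      map_smul' := fun c η => by ext; simp }
  let E2 : Module.End F (BiForm F p) :=
    { toFun := fun η => η ∘ₗ ad
      map_add' := fun η ζ => by ext; simp
      map_smul' := fun c η => by ext; simp }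
  let E3 : Module.End F (BiForm F p) :=
    { toFun := fun η => η.compl₂ ad
      map_add' := fun η ζ => by ext; simp
      map_smul' := fun c η => by ext; simp }
  have h12 : Commute E1 E2 := LinearMap.ext fun η => rfl
  have h13 : Commute E1 E3 := LinearMap.ext fun η => rfl
  have h23 : Commute E2 E3 := LinearMap.ext fun η => rfl
  have e1 : ∀ n η A B, (E1 ^ n) η A B =
      ((D : Module.End F (TruncPoly F p)) ^ n) (η A B) := by
    intro n
    induction n with
    | zero => intro η A B; rfl
    | succ n ih => intro η A B; rw [pow_succ, Module.End.mul_apply, ih]; rfl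
  have e2 : ∀ n η A B, (E2 ^ n) η A B = η ((ad ^ n) A) B := by
    intro n
    induction n with
    | zero => intro η A B; rfl
    | succ n ih =>
      intro η A B
      rw [pow_succ, Module.End.mul_apply, ih, pow_succ']; rfl
  have e3 : ∀ n η A B, (E3 ^ n) η A B = η A ((ad ^ n) B) := by
    intro n
    induction n with
    | zero => intro η A B; rfl
    | succ n ih =>
      intro η A B
      rw [pow_succ, Module.End.mul_apply, ih, pow_succ']; rfl
  rw [mem_formStabilizer]
  intro A B
  have h0 : (E1 - E2 - E3) ω = 0 := hD
  have : Nontrivial (BiForm F p) := by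
    refine ⟨⟨areaForm 1, 0, fun h => ?_⟩⟩
    have := congrArg (fun η : BiForm F p => η (partialD F p 0) (partialD F p 1)) h
    simp [areaForm_apply, partialD_gen] at this
  have : CharP (Module.End F (BiForm F p)) p :=
    charP_of_injective_algebraMap (algebraMap F _).injective p
  have hpow : ∀ n : ℕ, n ≠ 0 → ((E1 - E2 - E3) ^ n) ω = 0 := by
    intro n hn
    obtain ⟨n, rfl⟩ := Nat.exists_eq_succ_of_ne_zero hn
    rw [pow_succ, Module.End.mul_apply, h0, map_zero]
  have hp := hpow p (Fact.out : p.Prime).ne_zero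
  have hs : (E1 - E2 - E3) ^ p = E1 ^ p - E2 ^ p - E3 ^ p :=
    sub_sub_pow_char (R := Module.End F (BiForm F p)) h12 h13 h23
  rw [hs] at hp
  have h := congrArg (fun η : BiForm F p => η A B) hp
  simp only [LinearMap.sub_apply, e1, e2, e3, LinearMap.zero_apply] at h
  rw [wittP_apply, wittP_lie, wittP_lie]
  linear_combination h

/-- The Hamiltonian Lie algebra `H(2;1;Φ(τ))`: the derivations that annihilate the `2`-form
`(1 + x ^ (p - 1) y ^ (p - 1)) dx ∧ dy`. -/
noncomputable def hamTau (F : Type*) [Field F] (p : ℕ) : LieSubalgebra F (Witt F p) :=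
  formStabilizer (areaForm (1 + gen F p 0 ^ (p - 1) * gen F p 1 ^ (p - 1)))

theorem mem_stabilizer_areaForm [CharP F p] {u : TruncPoly F p} {D : Witt F p} :
    D ∈ formStabilizer (areaForm u) ↔
      partialD F p 0 (u * D (gen F p 0)) + partialD F p 1 (u * D (gen F p 1)) = 0 := by
  have key : ∀ A B : Witt F p, D (areaForm u A B) - (areaForm u ⁅D, A⁆ B + areaForm u A ⁅D, B⁆) =
      (partialD F p 0 (u * D (gen F p 0)) + partialD F p 1 (u * D (gen F p 1))) *
      (A (gen F p 0) * B (gen F p 1) - A (gen F p 1) * B (gen F p 0)) := by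
    intro A B
    simp only [areaForm_apply, Derivation.commutator_apply, Derivation.leibniz, map_sub,
      smul_eq_mul]
    rw [witt_apply A (D (gen F p 0)), witt_apply A (D (gen F p 1)),
      witt_apply B (D (gen F p 0)), witt_apply B (D (gen F p 1)), witt_apply D u]
    ring
  rw [mem_formStabilizer]
  constructor
  · intro h
    have := key (partialD F p 0) (partialD F p 1)
    rw [← h, sub_self] at this
    simpa [partialD_gen] using this.symm
  · intro h A B
    have := key A B
    rw [h, zero_mul, sub_eq_zero] at this
    exact this

end Hamiltonian

section ThePEnvelope

/-- `Γ = x ^ (p - 1) ∂_y`. -/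
noncomputable def gammaD (F : Type*) [Field F] (p : ℕ) [CharP F p] : Witt F p :=
  gen F p 0 ^ (p - 1) • partialD F p 1

/-- `Θ = - y ^ (p - 1) ∂_x`. -/
noncomputable def thetaD (F : Type*) [Field F] (p : ℕ) [CharP F p] : Witt F p :=
  -(gen F p 1 ^ (p - 1) • partialD F p 0)

/-- The derived subalgebra `H(2;1;Φ(τ))^{(1)}`, as a subspace of `W(2;1)`. -/
noncomputable def derivedHamTau (F : Type*) [Field F] (p : ℕ) : Submodule F (Witt F p) :=
  (LieAlgebra.derivedSeries F (hamTau F p) 1).toSubmodule.map (hamTau F p).toSubmodule.subtype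

variable {F : Type*} [Field F] {p : ℕ}

theorem lie_mem_derivedHamTau {D E : Witt F p} (hD : D ∈ hamTau F p) (hE : E ∈ hamTau F p) :
    ⁅D, E⁆ ∈ derivedHamTau F p :=
  ⟨⁅(⟨D, hD⟩ : hamTau F p), (⟨E, hE⟩ : hamTau F p)⁆, by
    simpa [LieAlgebra.derivedSeries_def, LieAlgebra.derivedSeriesOfIdeal_succ] using
      LieSubmodule.lie_mem_lie (LieSubmodule.mem_top (⟨D, hD⟩ : hamTau F p))
        (LieSubmodule.mem_top (⟨E, hE⟩ : hamTau F p)), rfl⟩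

theorem derivedHamTau_le {D : Witt F p} (hD : D ∈ derivedHamTau F p) : D ∈ hamTau F p := by
  obtain ⟨D, -, rfl⟩ := hD
  exact D.2

variable [CharP F p]

section Helpers

variable (F p) in
/-- `x ^ (p - 1) y ^ (p - 1)`. -/
noncomputable def topMon : TruncPoly F p := gen F p 0 ^ (p - 1) * gen F p 1 ^ (p - 1)

theorem mem_hamTau {D : Witt F p} :
    D ∈ hamTau F p ↔ partialD F p 0 ((1 + topMon F p) * D (gen F p 0)) +
      partialD F p 1 ((1 + topMon F p) * D (gen F p 1)) = 0 :=
  mem_stabilizer_areaForm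

theorem gen_pow_of_le {i : Fin 2} {n : ℕ} (hn : p ≤ n) : gen F p i ^ n = 0 := by
  obtain ⟨m, rfl⟩ := Nat.exists_eq_add_of_le hn
  rw [pow_add, gen_pow, zero_mul]

variable [Fact p.Prime]

theorem two_le : 2 ≤ p := (Fact.out : p.Prime).two_le

theorem topMon_mul_gen (i : Fin 2) : topMon F p * gen F p i = 0 := by
  have h2 : 2 ≤ p := two_le
  have h (j : Fin 2) : gen F p j ^ (p - 1) * gen F p j = 0 := by
    rw [← pow_succ]; exact gen_pow_of_le (by omega)
  fin_cases i
  · change gen F p 0 ^ (p - 1) * gen F p 1 ^ (p - 1) * gen F p 0 = 0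
    linear_combination gen F p 1 ^ (p - 1) * h 0
  · change gen F p 0 ^ (p - 1) * gen F p 1 ^ (p - 1) * gen F p 1 = 0
    linear_combination gen F p 0 ^ (p - 1) * h 1

theorem topMon_mul_gen_pow (i : Fin 2) : topMon F p * gen F p i ^ (p - 1) = 0 := by
  have h2 : 2 ≤ p := two_le
  obtain ⟨n, hn⟩ := Nat.exists_eq_add_of_le (show 1 ≤ p - 1 by omega)
  rw [hn, pow_add, pow_one, ← mul_assoc, topMon_mul_gen, zero_mul]

theorem topMon_sq : topMon F p * topMon F p = 0 := by
  have h : topMon F p = gen F p 0 ^ (p - 1) * gen F p 1 ^ (p - 1) := rfl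
  linear_combination topMon F p * h + gen F p 1 ^ (p - 1) * topMon_mul_gen_pow (F := F) (p := p) 0

theorem topMon_mul (f : TruncPoly F p) : ∃ a : F, topMon F p * f = a • topMon F p := by
  obtain ⟨f, rfl⟩ := toTrunc_surjective f
  induction f using MvPolynomial.induction_on with
  | C a =>
    exact ⟨a, by rw [← MvPolynomial.algebraMap_eq, AlgHom.commutes, Algebra.smul_def, mul_comm]⟩
  | add f g hf hg =>
    obtain ⟨a, ha⟩ := hf
    obtain ⟨b, hb⟩ := hg
    exact ⟨a + b, by rw [map_add, mul_add, ha, hb, add_smul]⟩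
  | mul_X f i hf =>
    refine ⟨0, ?_⟩
    have h := topMon_mul_gen (F := F) (p := p) i
    unfold gen at h
    rw [map_mul, zero_smul]
    linear_combination toTrunc F p f * h

/-- The operator `D_Λ(h) = Λ (∂_x(h) ∂_y - ∂_y(h) ∂_x)` with `Λ = 1 - x ^ (p - 1) y ^ (p - 1)`. -/
noncomputable def hamD : TruncPoly F p →ₗ[F] Witt F p where
  toFun h := (1 - topMon F p) • (partialD F p 0 h • partialD F p 1 -
    partialD F p 1 h • partialD F p 0)
  map_add' f g := by simp only [map_add, add_smul]; module
  map_smul' c f := by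
    refine Derivation.ext fun g => ?_
    simp [← smul_sub]

theorem hamD_apply (h f : TruncPoly F p) :
    hamD h f = (1 - topMon F p) * (partialD F p 0 h * partialD F p 1 f -
      partialD F p 1 h * partialD F p 0 f) := by
  simp [hamD]

theorem hamD_one : hamD (1 : TruncPoly F p) = 0 :=
  Derivation.ext fun f => by simp [hamD_apply]

theorem hamD_mem (h : TruncPoly F p) : hamD h ∈ hamTau F p := by
  have hu : (1 + topMon F p) * (1 - topMon F p) = 1 := by
    linear_combination -topMon_sq (F := F) (p := p)
  rw [mem_hamTau, hamD_apply, hamD_apply, ← mul_assoc, ← mul_assoc, hu]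
  simp [partialD_gen, partialD_comm 1 0]

theorem lie_hamD (f g : TruncPoly F p) :
    ⁅hamD f, hamD g⁆ = hamD ((1 - topMon F p) * (partialD F p 0 f * partialD F p 1 g -
      partialD F p 1 f * partialD F p 0 g)) := by
  refine witt_ext fun i => ?_
  rw [Derivation.commutator_apply]
  fin_cases i <;>
  · simp [hamD_apply, partialD_gen, Derivation.leibniz, partialD_comm 1 0]
    ring

/-- A partial antiderivative. -/
noncomputable def antider (i : Fin 2) (n : ℕ) (f : TruncPoly F p) : TruncPoly F p :=
  ∑ k ∈ Finset.range n, ((-1) ^ k * ((k + 1).factorial : F)⁻¹) •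
    (gen F p i ^ (k + 1) * ((partialD F p i : Module.End F (TruncPoly F p)) ^ k) f)

theorem partialD_antider (i : Fin 2) {n : ℕ} (hn : n < p) (f : TruncPoly F p) :
    partialD F p i (antider i n f) = f - ((-1) ^ n * (n.factorial : F)⁻¹) •
      (gen F p i ^ n * ((partialD F p i : Module.End F (TruncPoly F p)) ^ n) f) := by
  induction n with
  | zero => simp [antider]
  | succ n ih =>
    rw [antider, Finset.sum_range_succ, ← antider, map_add, ih (by omega)]
    have h1 : ((n + 1 : ℕ) : F) ≠ 0 := by
      rw [Ne, CharP.cast_eq_zero_iff F p]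
      exact Nat.not_dvd_of_pos_of_lt (by omega) hn
    have h2 : ((n.factorial : ℕ) : F) ≠ 0 := by
      rw [Ne, CharP.cast_eq_zero_iff F p, (Fact.out : p.Prime).dvd_factorial]
      omega
    have h3 : (((n + 1).factorial : F)⁻¹) * ((n + 1 : ℕ) : F) = (n.factorial : F)⁻¹ := by
      rw [Nat.factorial_succ, Nat.cast_mul]
      field_simp
    rw [Derivation.map_smul, Derivation.leibniz, Derivation.leibniz_pow, partialD_gen, if_pos rfl,
      pow_succ' (partialD F p i : Module.End F (TruncPoly F p)), Module.End.mul_apply,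
      ← h3, nsmul_eq_mul]
    simp only [smul_eq_mul, mul_one, Nat.add_sub_cancel, Derivation.coeFn_coe,
      Algebra.smul_def, map_mul, map_pow, map_neg, map_one, map_natCast]
    ring

theorem partialD_pow_comm (i j : Fin 2) (n : ℕ) (f : TruncPoly F p) :
    partialD F p j (((partialD F p i : Module.End F (TruncPoly F p)) ^ n) f) =
      ((partialD F p i : Module.End F (TruncPoly F p)) ^ n) (partialD F p j f) := by
  induction n generalizing f with
  | zero => rfl
  | succ n ih =>
    rw [pow_succ, Module.End.mul_apply, ih, Module.End.mul_apply, Derivation.coeFn_coe,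
      partialD_comm]

theorem partialD_antider_of_ne {i j : Fin 2} (hij : j ≠ i) (n : ℕ) (f : TruncPoly F p)
    (hf : partialD F p j f = 0) : partialD F p j (antider i n f) = 0 := by
  rw [antider, map_sum]
  refine Finset.sum_eq_zero fun k _ => ?_
  rw [Derivation.map_smul, Derivation.leibniz, Derivation.leibniz_pow, partialD_gen, if_neg hij,
    partialD_pow_comm, hf]
  simp

theorem partialD_pow_char (i : Fin 2) (f : TruncPoly F p) :
    ((partialD F p i : Module.End F (TruncPoly F p)) ^ p) f = 0 := by
  have h : wittP (partialD F p i) = 0 := by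
    refine witt_ext fun j => ?_
    obtain ⟨n, hn⟩ := Nat.exists_eq_add_of_le (show 2 ≤ p from two_le)
    have h2 : ∀ m : ℕ, ((partialD F p i : Module.End F (TruncPoly F p)) ^ (2 + m)) (gen F p j)
        = 0 := by
      intro m
      rw [add_comm, pow_add, pow_two, Module.End.mul_apply, Module.End.mul_apply,
        Derivation.coeFn_coe, partialD_gen]
      split_ifs <;> simp
    have h3 := h2 (p - 2)
    rw [Nat.add_sub_cancel' two_le] at h3
    exact h3
  rw [← wittP_apply, h, Derivation.zero_apply]

theorem mem_truncIdeal {f : MvPolynomial (Fin 2) F} :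
    f ∈ truncIdeal F p ↔ ∀ m ∈ f.support, ∃ i, p ≤ m i := by
  have h : truncIdeal F p = Ideal.span ((fun s => MvPolynomial.monomial s (1 : F)) ''
      Set.range fun i : Fin 2 => Finsupp.single i p) := by
    rw [truncIdeal, ← Set.range_comp]
    congr 2
    funext i
    simp [MvPolynomial.X_pow_eq_monomial]
  rw [h, MvPolynomial.mem_ideal_span_monomial_image]
  simp [Finsupp.single_le_iff]

theorem exists_eq_algebraMap (f : TruncPoly F p) (hf : ∀ i, partialD F p i f = 0) :
    ∃ a : F, f = algebraMap F _ a := by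
  obtain ⟨f, rfl⟩ := toTrunc_surjective f
  refine ⟨f.coeff 0, ?_⟩
  rw [← AlgHom.commutes (toTrunc F p), MvPolynomial.algebraMap_eq, ← sub_eq_zero, ← map_sub,
    toTrunc_eq_zero, mem_truncIdeal]
  intro m hm
  by_contra! hlt
  have hm0 : m ≠ 0 := by
    rintro rfl
    simp at hm
  obtain ⟨i, hi⟩ : ∃ i, m i ≠ 0 := by
    by_contra! h
    exact hm0 (Finsupp.ext h)
  have hc : f.coeff m ≠ 0 := by
    rw [MvPolynomial.mem_support_iff, MvPolynomial.coeff_sub, MvPolynomial.coeff_C,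
      if_neg (Ne.symm hm0), sub_zero] at hm
    exact hm
  have h := hf i
  rw [partialD_mk, toTrunc_eq_zero, mem_truncIdeal] at h
  have hadd : m - Finsupp.single i 1 + Finsupp.single i 1 = m :=
    tsub_add_cancel_of_le (by simpa [Finsupp.single_le_iff] using Nat.one_le_iff_ne_zero.2 hi)
  obtain ⟨j, hj⟩ := h (m - Finsupp.single i 1) (by
    rw [MvPolynomial.mem_support_iff, MvPolynomial.coeff_pderiv, hadd]
    refine mul_ne_zero hc ?_
    have : ((m i : ℕ) : F) ≠ 0 := by
      rw [Ne, CharP.cast_eq_zero_iff F p]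
      exact Nat.not_dvd_of_pos_of_lt (Nat.pos_of_ne_zero hi) (hlt i)
    convert this using 1
    conv_rhs => rw [← hadd]
    simp)
  have : m j < p := hlt j
  simp at hj
  omega

theorem exists_potential (f g : TruncPoly F p)
    (hfg : partialD F p 0 f + partialD F p 1 g = 0) :
    ∃ (h : TruncPoly F p) (a b : F), f = -partialD F p 1 h + a • gen F p 1 ^ (p - 1) ∧
      g = partialD F p 0 h + b • gen F p 0 ^ (p - 1) := by
  have h2 : 2 ≤ p := two_le
  have hp : p - 1 < p := by omega
  have hpp (i : Fin 2) (k : TruncPoly F p) : partialD F p i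
      (((partialD F p i : Module.End F (TruncPoly F p)) ^ (p - 1)) k) = 0 := by
    have h : ((partialD F p i : Module.End F (TruncPoly F p)) ^ (p - 1 + 1)) k = 0 := by
      rw [Nat.sub_add_cancel (by omega), partialD_pow_char]
    rwa [pow_succ'] at h
  obtain ⟨a, ha⟩ := exists_eq_algebraMap
    (((partialD F p 1 : Module.End F (TruncPoly F p)) ^ (p - 1)) f) (by
      intro i
      fin_cases i
      · have : partialD F p 0 f = -partialD F p 1 g := by linear_combination hfg
        change partialD F p 0 _ = 0
        rw [partialD_pow_comm, this, map_neg, ← partialD_pow_comm, hpp, neg_zero]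
      · exact hpp 1 f)
  have e1 := partialD_antider 1 hp f
  rw [ha] at e1
  set h1 := -antider 1 (p - 1) f with hh1
  have hg1 : partialD F p 1 (g - partialD F p 0 h1) = 0 := by
    rw [map_sub, partialD_comm 1 0, hh1, map_neg, e1]
    simp [Derivation.leibniz, Derivation.leibniz_pow, partialD_gen]
    linear_combination hfg
  obtain ⟨b, hb⟩ := exists_eq_algebraMap
    (((partialD F p 0 : Module.End F (TruncPoly F p)) ^ (p - 1)) (g - partialD F p 0 h1)) (by
      intro i
      fin_cases i
      · exact hpp 0 _
      · change partialD F p 1 _ = 0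
        rw [partialD_pow_comm, hg1, map_zero])
  have e2 := partialD_antider 0 hp (g - partialD F p 0 h1)
  rw [hb] at e2
  have e3 := partialD_antider_of_ne (show (1 : Fin 2) ≠ 0 by decide) (p - 1) _ hg1
  refine ⟨h1 + antider 0 (p - 1) (g - partialD F p 0 h1),
    (-1) ^ (p - 1) * ((p - 1).factorial : F)⁻¹ * a,
    (-1) ^ (p - 1) * ((p - 1).factorial : F)⁻¹ * b, ?_, ?_⟩
  · rw [map_add, e3, hh1, map_neg, e1]
    simp only [Algebra.smul_def, map_mul]
    ring
  · rw [map_add, e2]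
    simp only [Algebra.smul_def, map_mul]
    ring

theorem hamD_topMon_mem : hamD (topMon F p) ∈ derivedHamTau F p := by
  have h := lie_mem_derivedHamTau (hamD_mem (gen F p 0)) (hamD_mem (gen F p 1))
  rw [lie_hamD] at h
  simp only [partialD_gen] at h
  simp [hamD_one] at h
  exact h

theorem hamD_topMon_mul_mem (f : TruncPoly F p) :
    hamD (topMon F p * f) ∈ derivedHamTau F p := by
  obtain ⟨a, ha⟩ := topMon_mul f
  rw [ha, map_smul]
  exact Submodule.smul_mem _ _ hamD_topMon_mem

theorem hamD_partialD_mem (i : Fin 2) (f : TruncPoly F p) :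
    hamD (partialD F p i f) ∈ derivedHamTau F p := by
  have e : partialD F p i f = (1 - topMon F p) * partialD F p i f +
    topMon F p * partialD F p i f := by ring
  rw [e, map_add]
  refine add_mem ?_ (hamD_topMon_mul_mem _)
  fin_cases i
  · have h := lie_mem_derivedHamTau (hamD_mem f) (hamD_mem (gen F p 1))
    rw [lie_hamD] at h
    simpa [partialD_gen] using h
  · have h := lie_mem_derivedHamTau (hamD_mem (gen F p 0)) (hamD_mem f)
    rw [lie_hamD] at h
    simpa [partialD_gen] using h

theorem hamD_mem_derived (h : TruncPoly F p) : hamD h ∈ derivedHamTau F p := by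
  have h2 : 2 ≤ p := two_le
  have hp : p - 1 < p := by omega
  have e (i : Fin 2) (f : TruncPoly F p) : ∃ k g, f = partialD F p i k + gen F p i ^ (p - 1) * g :=
    ⟨antider i (p - 1) f, ((-1) ^ (p - 1) * ((p - 1).factorial : F)⁻¹) •
      ((partialD F p i : Module.End F (TruncPoly F p)) ^ (p - 1)) f, by
        rw [partialD_antider i hp f, mul_smul_comm]; ring⟩
  obtain ⟨k, g, hk⟩ := e 1 h
  obtain ⟨k', g', hk'⟩ := e 0 g
  have e3 : h = partialD F p 1 k + partialD F p 0 (gen F p 1 ^ (p - 1) * k') +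
      topMon F p * g' := by
    rw [hk, hk', topMon]
    simp [Derivation.leibniz, Derivation.leibniz_pow, partialD_gen]
    ring
  rw [e3, map_add, map_add]
  exact add_mem (add_mem (hamD_partialD_mem _ _) (hamD_partialD_mem _ _)) (hamD_topMon_mul_mem _)

end Helpers

theorem gammaD_mem [Fact p.Prime] : gammaD F p ∈ hamTau F p := by
  rw [mem_hamTau]
  simp [gammaD, partialD_gen, add_mul, topMon_mul_gen_pow, Derivation.leibniz_pow]

theorem thetaD_mem [Fact p.Prime] : thetaD F p ∈ hamTau F p := by
  rw [mem_hamTau]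
  simp [thetaD, partialD_gen, add_mul, topMon_mul_gen_pow, Derivation.leibniz_pow]

theorem algL_aux [Fact p.Prime] :
    derivedHamTau F p ⊔ Submodule.span F {gammaD F p, thetaD F p} ≤ (hamTau F p).toSubmodule := by
  refine sup_le (fun D hD => derivedHamTau_le hD) (Submodule.span_le.2 ?_)
  rintro D (rfl | rfl)
  · exact gammaD_mem
  · exact thetaD_mem

/-- The Lie algebra `L = H(2;1;Φ(τ))^{(1)} ⊕ F Γ ⊕ F Θ`. -/
noncomputable def algL (F : Type*) [Field F] (p : ℕ) [Fact p.Prime] [CharP F p] :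
    LieSubalgebra F (Witt F p) :=
  { derivedHamTau F p ⊔ Submodule.span F {gammaD F p, thetaD F p} with
    lie_mem' := by
      intro D E hD hE
      exact Submodule.mem_sup_left (lie_mem_derivedHamTau (algL_aux hD) (algL_aux hE)) }

/-- `L` is in fact all of `H(2;1;Φ(τ))`. -/
theorem algL_eq [Fact p.Prime] : algL F p = hamTau F p := by
  refine le_antisymm algL_aux ?_
  · intro D hD
    obtain ⟨h, a, b, h0, h1⟩ := exists_potential _ _ (mem_hamTau.1 hD)
    have hu : (1 - topMon F p) * (1 + topMon F p) = 1 := by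
      linear_combination -topMon_sq (F := F) (p := p)
    have e : D = hamD h + ((-a) • thetaD F p + b • gammaD F p) := by
      refine witt_ext fun i => ?_
      fin_cases i
      · have t := topMon_mul_gen_pow (F := F) (p := p) 1
        simp [hamD_apply, partialD_gen, gammaD, thetaD]
        rw [Algebra.smul_def] at h0 ⊢
        linear_combination (1 - topMon F p) * h0 - D (gen F p 0) * hu -
          algebraMap F (TruncPoly F p) a * t
      · have t := topMon_mul_gen_pow (F := F) (p := p) 0
        simp [hamD_apply, partialD_gen, gammaD, thetaD]
        rw [Algebra.smul_def] at h1 ⊢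
        linear_combination (1 - topMon F p) * h1 - D (gen F p 1) * hu -
          algebraMap F (TruncPoly F p) b * t
    rw [e]
    refine add_mem (Submodule.mem_sup_left (hamD_mem_derived h)) (Submodule.mem_sup_right ?_)
    exact add_mem (Submodule.smul_mem _ _ (Submodule.subset_span (by simp)))
      (Submodule.smul_mem _ _ (Submodule.subset_span (by simp)))

/-- `L` is a `p`-subalgebra of `W(2;1)`. -/
theorem wittP_mem_algL [Fact p.Prime] {D : Witt F p} (hD : D ∈ algL F p) :
    wittP D ∈ algL F p := by
  rw [algL_eq] at hD ⊢
  exact wittP_mem_formStabilizer hD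

end ThePEnvelope

section RestrictedEnveloping

/-- The relations `x ^ p = x^[p]`, for all `x` in `G`, in the universal enveloping algebra of `G`. -/
inductive PRel (F : Type*) [Field F] (p : ℕ) {G : Type*} [LieRing G] [LieAlgebra F G]
    (pm : G → G) : UniversalEnvelopingAlgebra F G → UniversalEnvelopingAlgebra F G → Prop
  | of (x : G) : PRel F p pm (UniversalEnvelopingAlgebra.ι F x ^ p)
      (UniversalEnvelopingAlgebra.ι F (pm x))

/-- The restricted universal enveloping algebra `u(G) = u(G, 0)` of a Lie algebra `G` with
`[p]`-map `pm`. -/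
def RestrictedEnv (F : Type*) [Field F] (p : ℕ) {G : Type*} [LieRing G] [LieAlgebra F G]
    (pm : G → G) : Type _ :=
  RingQuot (PRel F p pm)

variable {F : Type*} [Field F] {p : ℕ} {G : Type*} [LieRing G] [LieAlgebra F G] {pm : G → G}

instance : Ring (RestrictedEnv F p pm) := inferInstanceAs (Ring (RingQuot (PRel F p pm)))

instance : Algebra F (RestrictedEnv F p pm) :=
  inferInstanceAs (Algebra F (RingQuot (PRel F p pm)))

/-- The canonical homomorphism of Lie algebras `G → u(G)`. -/
def RestrictedEnv.ι (F : Type*) [Field F] (p : ℕ) {G : Type*} [LieRing G] [LieAlgebra F G]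
    (pm : G → G) : G →ₗ⁅F⁆ RestrictedEnv F p pm :=
  (AlgHom.toLieHom (RingQuot.mkAlgHom F (PRel F p pm) :
    UniversalEnvelopingAlgebra F G →ₐ[F] RestrictedEnv F p pm)).comp
      (UniversalEnvelopingAlgebra.ι F)

theorem RestrictedEnv.ι_pm (x : G) : RestrictedEnv.ι F p pm (pm x) =
    RestrictedEnv.ι F p pm x ^ p :=
  (RingQuot.mkAlgHom_rel F (PRel.of x)).symm.trans
    (map_pow (RingQuot.mkAlgHom F (PRel F p pm)) _ _)

/-- The universal property of `u(G)`: a homomorphism of Lie algebras `f` into an associative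
algebra with `f (x^[p]) = f x ^ p` extends to `u(G)`. -/
def RestrictedEnv.lift {A : Type*} [Ring A] [Algebra F A] (f : G →ₗ⁅F⁆ A)
    (hf : ∀ x, f (pm x) = f x ^ p) : RestrictedEnv F p pm →ₐ[F] A :=
  RingQuot.liftAlgHom F ⟨UniversalEnvelopingAlgebra.lift F f, by
    rintro _ _ ⟨x⟩
    rw [map_pow, UniversalEnvelopingAlgebra.lift_ι_apply,
      UniversalEnvelopingAlgebra.lift_ι_apply, hf]⟩

end RestrictedEnveloping

section Induction

variable {F : Type*} [Field F] {A B : Type*} [Ring A] [Algebra F A] [Ring B] [Algebra F B]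

/-- The relations `a b ⊗ v = a ⊗ b v` (`a` in `A`, `b` in `B`, `v` in `V`) in `A ⊗_F V`. -/
def balancedRel (φ : B →ₐ[F] A) {V : Type*} [AddCommGroup V] [Module F V]
    (ρ : B →ₐ[F] Module.End F V) : Submodule A (A ⊗[F] V) :=
  Submodule.span A {t | ∃ (a : A) (b : B) (v : V), t = (a * φ b) ⊗ₜ[F] v - a ⊗ₜ[F] ρ b v}

/-- The `A`-module `A ⊗_B V`, for a homomorphism of algebras `φ : B → A` and a `B`-module `V` with
structure map `ρ`. -/
abbrev Induced (φ : B →ₐ[F] A) {V : Type*} [AddCommGroup V] [Module F V]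
    (ρ : B →ₐ[F] Module.End F V) : Type _ :=
  (A ⊗[F] V) ⧸ balancedRel φ ρ

end Induction

section Filtration

variable {F : Type*} [Field F] {p : ℕ} [Fact p.Prime] [CharP F p]

/-- The `[p]`-map of `L`: the `p`-th power of derivations. -/
noncomputable def pmapL (F : Type*) [Field F] (p : ℕ) [Fact p.Prime] [CharP F p]
    (D : algL F p) : algL F p :=
  ⟨wittP D.1, wittP_mem_algL D.2⟩

theorem aug_apply_eq_zero {D : Witt F p} (hD : ∀ i, aug F p (D (gen F p i)) = 0)
    (f : TruncPoly F p) : aug F p (D f) = 0 := by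
  rw [witt_apply, map_add, map_mul, map_mul, hD, hD]
  simp

/-- The subalgebra `L_(0)` of `L`: the elements `f ∂_x + g ∂_y` of `L` such that `f` and `g` have
zero constant term, that is, whose homogeneous components all have degree at least `0`. -/
noncomputable def algL0 (F : Type*) [Field F] (p : ℕ) [Fact p.Prime] [CharP F p] :
    LieSubalgebra F (algL F p) where
  carrier := {D | ∀ i, aug F p (D.1 (gen F p i)) = 0}
  zero_mem' := fun i => by simp
  add_mem' := fun hD hE i => by
    have h1 := hD i
    have h2 := hE i
    simp [h1, h2]
  smul_mem' := fun c D hD i => by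
    have h1 := hD i
    simp [h1]
  lie_mem' := fun {D E} hD hE i => by
    change aug F p (⁅D.1, E.1⁆ (gen F p i)) = 0
    rw [Derivation.commutator_apply, map_sub, aug_apply_eq_zero hD, aug_apply_eq_zero hE, sub_zero]

theorem pmapL_mem {D : algL F p} (hD : D ∈ algL0 F p) : pmapL F p D ∈ algL0 F p := by
  intro i
  change aug F p (((D.1 : Module.End F (TruncPoly F p)) ^ p) (gen F p i)) = 0
  obtain ⟨n, hn⟩ := Nat.exists_eq_succ_of_ne_zero (Fact.out : p.Prime).ne_zero
  have h : ∀ m : ℕ, aug F p (((D.1 : Module.End F (TruncPoly F p)) ^ (m + 1)) (gen F p i)) = 0 := by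
    intro m
    rw [pow_succ', Module.End.mul_apply]
    exact aug_apply_eq_zero hD _
  have h2 := h (p - 1)
  rwa [Nat.sub_add_cancel (Fact.out : p.Prime).one_le] at h2

/-- The `[p]`-map of `L_(0)`. -/
noncomputable def pmapL0 (F : Type*) [Field F] (p : ℕ) [Fact p.Prime] [CharP F p]
    (D : algL0 F p) : algL0 F p :=
  ⟨pmapL F p D.1, pmapL_mem D.2⟩

/-- The homomorphism `u(L_(0)) → u(L)` induced by the inclusion of `L_(0)` in `L`. -/
noncomputable def inclEnv (F : Type*) [Field F] (p : ℕ) [Fact p.Prime] [CharP F p] :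
    RestrictedEnv F p (pmapL0 F p) →ₐ[F] RestrictedEnv F p (pmapL F p) :=
  RestrictedEnv.lift ((RestrictedEnv.ι F p (pmapL F p)).comp (algL0 F p).incl)
    fun x => RestrictedEnv.ι_pm (pm := pmapL F p) x.1

/-- The matrix `M` of the linear part of a derivation `D`, with
`D(x_j) = ∑ i, M i j x_i + (terms of degree ≠ 1)`. -/
noncomputable def linMat (D : Witt F p) : Matrix (Fin 2) (Fin 2) F :=
  Matrix.of fun i j => aug F p (partialD F p i (D (gen F p j)))

theorem aug_partialD_apply {D : Witt F p} (hD : ∀ i, aug F p (D (gen F p i)) = 0)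
    (f : TruncPoly F p) (i : Fin 2) : aug F p (partialD F p i (D f)) =
      ∑ k, linMat D i k * aug F p (partialD F p k f) := by
  rw [witt_apply D f]
  simp [Derivation.leibniz, hD, linMat, mul_comm]

theorem linMat_lie {D E : Witt F p} (hD : ∀ i, aug F p (D (gen F p i)) = 0)
    (hE : ∀ i, aug F p (E (gen F p i)) = 0) : linMat ⁅D, E⁆ = ⁅linMat D, linMat E⁆ := by
  ext i j
  rw [LieRing.of_associative_ring_bracket, Matrix.sub_apply, Matrix.mul_apply, Matrix.mul_apply]
  change aug F p (partialD F p i (⁅D, E⁆ (gen F p j))) = _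
  rw [Derivation.commutator_apply, map_sub, map_sub, aug_partialD_apply hD, aug_partialD_apply hE]
  rfl

theorem linMat_wittP {D : Witt F p} (hD : ∀ i, aug F p (D (gen F p i)) = 0) :
    linMat (wittP D) = linMat D ^ p := by
  have h : ∀ (n : ℕ) (i j : Fin 2), aug F p (partialD F p i
      (((D : Module.End F (TruncPoly F p)) ^ n) (gen F p j))) = (linMat D ^ n) i j := by
    intro n
    induction n with
    | zero =>
      intro i j
      rw [pow_zero, pow_zero, Module.End.one_apply, partialD_gen, Matrix.one_apply]
      split_ifs <;> simp
    | succ n ih =>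
      intro i j
      rw [pow_succ', Module.End.mul_apply, Derivation.coeFn_coe, aug_partialD_apply hD, pow_succ',
        Matrix.mul_apply]
      exact Finset.sum_congr rfl fun k _ => by rw [ih]
  ext i j
  exact h p i j

theorem trace_linMat {D : Witt F p} (hD : D ∈ algL F p)
    (hD0 : ∀ i, aug F p (D (gen F p i)) = 0) : (linMat D).trace = 0 := by
  rw [algL_eq, mem_hamTau] at hD
  have htop : aug F p (topMon F p) = 0 := by
    have h2 : p - 1 ≠ 0 := by
      have := (Fact.out : p.Prime).two_le
      omega
    simp [topMon, aug_gen, h2]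
  have h := congrArg (aug F p) hD
  simp [Derivation.leibniz, htop, hD0] at h
  simpa [Matrix.trace, linMat] using h

/-- The special linear Lie algebra `sl_2(F)`. -/
abbrev Sl2 (F : Type*) [Field F] : Type _ := LieAlgebra.SpecialLinear.sl (Fin 2) F

/-- The homomorphism `L_(0) → L_(0) / L_(1) ≅ sl_2(F)` that sends `D` to the matrix of its
linear part (its homogeneous component of degree `0`). -/
noncomputable def linPart (F : Type*) [Field F] (p : ℕ) [Fact p.Prime] [CharP F p] :
    algL0 F p →ₗ⁅F⁆ Sl2 F where
  toFun D := ⟨linMat D.1.1, trace_linMat D.1.2 D.2⟩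
  map_add' D E := by
    refine Subtype.ext (Matrix.ext fun i j => ?_)
    simp [linMat]
  map_smul' c D := by
    refine Subtype.ext (Matrix.ext fun i j => ?_)
    simp [linMat]
  map_lie' {D E} := Subtype.ext (linMat_lie D.2 E.2)

end Filtration

section Modules

/-- The element `e` of `sl_2(F)`. -/
def sl2E (F : Type*) [Field F] : Sl2 F :=
  ⟨!![0, 1; 0, 0], by
    change Matrix.trace (_ : Matrix (Fin 2) (Fin 2) F) = 0
    simp [Matrix.trace_fin_two]⟩

/-- The element `h` of `sl_2(F)`. -/
def sl2H (F : Type*) [Field F] : Sl2 F :=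
  ⟨!![1, 0; 0, -1], by
    change Matrix.trace (_ : Matrix (Fin 2) (Fin 2) F) = 0
    simp [Matrix.trace_fin_two]⟩

/-- `V` is an irreducible restricted `sl_2(F)`-module of highest weight `l`, where the `[p]`-map of
`sl_2(F)` is the `p`-th power of matrices. Up to isomorphism, this is the module `V(l)`. -/
structure IsSimpleOfHighestWeight (F : Type*) [Field F] (p : ℕ) (V : Type*) [AddCommGroup V]
    [Module F V] [LieRingModule (Sl2 F) V] [LieModule F (Sl2 F) V] (l : ℕ) : Prop where
  irreducible : LieModule.IsIrreducible F (Sl2 F) V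
  restricted : ∀ a b : Sl2 F, (b : Matrix (Fin 2) (Fin 2) F) = (a : Matrix (Fin 2) (Fin 2) F) ^ p →
    LieModule.toEnd F (Sl2 F) V b = LieModule.toEnd F (Sl2 F) V a ^ p
  highest : ∃ v : V, v ≠ 0 ∧ ⁅sl2E F, v⁆ = 0 ∧ ⁅sl2H F, v⁆ = (l : F) • v

variable {F : Type*} [Field F] {p : ℕ} [Fact p.Prime] [CharP F p] {V : Type*} [AddCommGroup V]
  [Module F V] [LieRingModule (Sl2 F) V] [LieModule F (Sl2 F) V] {l : ℕ}

/-- The inflation of `V(l)` along `L_(0) → sl_2(F)`, as a representation of `u(L_(0))`. -/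
noncomputable def inflation (hV : IsSimpleOfHighestWeight F p V l) :
    RestrictedEnv F p (pmapL0 F p) →ₐ[F] Module.End F V :=
  RestrictedEnv.lift ((LieModule.toEnd F (Sl2 F) V).comp (linPart F p)) fun D =>
    hV.restricted (linPart F p D) (linPart F p (pmapL0 F p D)) (linMat_wittP D.2)

/-- The induced module `M(l) = Ind_{L_(0)}^L(V(l), 0) = u(L) ⊗_{u(L_(0))} V(l)`. -/
abbrev indModule (hV : IsSimpleOfHighestWeight F p V l) : Type _ :=
  Induced (inclEnv F p) (inflation hV)

end Modules

end HamTau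

namespace HamTau

open MvPolynomial

/-! ### Symmetric forms on `O(2;1)` and the Lie derivative -/

section SymmetricForms

/-! The module `M(l)` is realised geometrically. Let `S` be the space of symmetric forms of degree
`l`, that is, homogeneous polynomials of degree `l` in `dx`, `dy` with coefficients in `O(2;1)`; it
has dimension `p ^ 2 (l + 1)`, and `L` acts on it by the Lie derivative, compatibly with `p`-th
powers. Write `t = x ^ (p - 1) y ^ (p - 1)`. Elements of `L_(0)` have traceless linear part and
therefore kill `t`, so the forms `t s`, with `s` a form with constant coefficients, are a copy of
`V(l)` inflated to `L_(0)` (`exists_polynomial_model`, `formDer_topForm`). Frobenius reciprocity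
gives an `L`-map `Φ : M(l) → S` with image generated by these top forms.

Every form is reached from the top forms by differentiating `t`, so `Φ` maps onto `S`
(`mem_of_topForm_mem`). The easy half of the Poincaré-Birkhoff-Witt theorem bounds `dim M(l)` by `p
^ 2 dim V` (`exists_surjective_indModule`), hence `Φ` is an isomorphism onto `S`.

For simplicity, let `N ≠ 0` be an `L`-stable subspace of `S`. The elements `(1 - t) ∂_i` of `L`
differentiate coefficients up to an error in the top forms, so some element of `N` does not vanish
at the origin (`exists_formAug_ne_zero`). The values at the origin form an `sl_2`-submodule of
`V(l)`, so some `n` in `N` has value `dx ^ l` there. The product of the actions of `x ^ 3 ∂_y` and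
`x ^ (p - 2) ∂_y` is `-6 x ^ (p - 1) e ^ 2`, with `e = dx ∂/∂(dy)`, and symmetrically for `y` and `f
= dy ∂/∂(dx)` (`formDer_formDer`). Applying both to `n` gives a multiple of `t e ^ 2 f ^ 2 dx ^ l =
2 l (l - 1) t dx ^ l`, which is nonzero exactly because `2 ≤ l < p`. Thus `N` contains a nonzero top
form, hence all of them, hence everything (`topForm_mem`, `isSimpleModule_induced`). -/

/-- Symmetric differential forms on `O(2;1)`: polynomials in `dx = X 0` and `dy = X 1`. -/
abbrev SymForm (F : Type*) [Field F] (p : ℕ) : Type _ := MvPolynomial (Fin 2) (TruncPoly F p)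

variable {F : Type*} [Field F] {p : ℕ}

/-- The action of a derivation on the coefficients of a symmetric form. -/
noncomputable def coeffDer (D : Witt F p) : Derivation F (SymForm F p) (SymForm F p) :=
  Derivation.mk'
    { toFun := fun n =>
        AddMonoidAlgebra.ofCoeff ((AddMonoidAlgebra.coeff n).mapRange D (map_zero D))
      map_add' := fun n m => by ext k; simp [MvPolynomial.coeff]
      map_smul' := fun c n => by ext k; simp [MvPolynomial.coeff] } (by
    intro a b
    ext k
    have h : ∀ (n : SymForm F p) k, MvPolynomial.coeff k
        (AddMonoidAlgebra.ofCoeff ((AddMonoidAlgebra.coeff n).mapRange D (map_zero D)) :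
          SymForm F p) =
          D (MvPolynomial.coeff k n) := fun n k => by
      simp [MvPolynomial.coeff]
    simp only [LinearMap.coe_mk, AddHom.coe_mk, smul_eq_mul]
    rw [mul_comm b, coeff_add, coeff_mul, coeff_mul, h, coeff_mul, map_sum,
      ← Finset.sum_add_distrib]
    refine Finset.sum_congr rfl fun x _ => ?_
    rw [Derivation.leibniz, h, h, smul_eq_mul, smul_eq_mul, mul_comm (D _)])

theorem coeff_coeffDer (D : Witt F p) (n : SymForm F p) (k : Fin 2 →₀ ℕ) :
    (coeffDer D n).coeff k = D (n.coeff k) := by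
  simp [coeffDer, MvPolynomial.coeff]

theorem coeffDer_monomial (D : Witt F p) (k : Fin 2 →₀ ℕ) (f : TruncPoly F p) :
    coeffDer D (monomial k f) = monomial k (D f) := by
  ext j
  rw [coeff_coeffDer, coeff_monomial, coeff_monomial]
  split_ifs <;> simp

theorem C_smul (c : F) (f : TruncPoly F p) : (C (c • f) : SymForm F p) = c • C f :=
  (smul_monomial c).symm

theorem coeffDer_C (D : Witt F p) (f : TruncPoly F p) :
    coeffDer D (C f) = C (D f) := coeffDer_monomial D 0 f

theorem coeffDer_X (D : Witt F p) (i : Fin 2) : coeffDer D (X i) = 0 := by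
  rw [X, coeffDer_monomial]; simp

variable [CharP F p]

/-- The differential of a function. -/
noncomputable def diff (f : TruncPoly F p) : SymForm F p :=
  ∑ i, C (partialD F p i f) * X i

/-- The Lie derivative on symmetric forms. -/
noncomputable def formDer (D : Witt F p) : Derivation F (SymForm F p) (SymForm F p) :=
  coeffDer D + (mkDerivation (TruncPoly F p) fun j => diff (D (gen F p j))).restrictScalars F

theorem formDer_apply (D : Witt F p) (n : SymForm F p) :
    formDer D n = coeffDer D n + ∑ j, diff (D (gen F p j)) * pderiv j n := by
  simp only [formDer, Derivation.add_apply]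
  congr 1
  have : mkDerivation (TruncPoly F p) (fun j => diff (D (gen F p j))) =
      ∑ j, diff (D (gen F p j)) • pderiv j := by
    refine derivation_ext fun i => ?_
    rw [mkDerivation_X]
    fin_cases i <;> simp [Fin.sum_univ_two, pderiv_X]
  rw [Derivation.restrictScalars_apply, this]
  simp [Fin.sum_univ_two]

theorem formDer_C (D : Witt F p) (f : TruncPoly F p) : formDer D (C f) = C (D f) := by
  simp [formDer_apply, coeffDer_C]

theorem formDer_X (D : Witt F p) (i : Fin 2) : formDer D (X i) = diff (D (gen F p i)) := by
  simp [formDer_apply, coeffDer_X, pderiv_X, Pi.single_apply]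

theorem formDer_ext {D E : Derivation F (SymForm F p) (SymForm F p)}
    (h : ∀ f, D (C f) = E (C f)) (h' : ∀ i, D (X i) = E (X i)) : D = E := by
  refine Derivation.ext fun n => ?_
  induction n using MvPolynomial.induction_on with
  | C a => exact h a
  | add f g hf hg => simp only [map_add, hf, hg]
  | mul_X f i hf => rw [Derivation.leibniz, Derivation.leibniz, hf, h']

/-- Equality of mixed partial derivatives. Since `dx` and `dy` are differentials, this reduces
brackets and powers of Lie derivatives on them to those of derivations of functions. -/
theorem formDer_diff (D : Witt F p) (f : TruncPoly F p) :
    formDer D (diff f) = diff (D f) := by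
  simp only [diff, Fin.sum_univ_two, map_add, Derivation.leibniz, formDer_C, formDer_X, smul_eq_mul]
  rw [witt_apply D f, witt_apply D (partialD F p 0 f), witt_apply D (partialD F p 1 f)]
  simp only [map_add, map_mul, Derivation.leibniz, smul_eq_mul, partialD_comm 1 0 f]
  ring

theorem diff_gen (i : Fin 2) : diff (gen F p i) = X i := by
  simp [diff, partialD_gen, apply_ite]

/-- The Lie derivative, as a homomorphism of Lie algebras. -/
noncomputable def formDerHom (F : Type*) [Field F] (p : ℕ) [CharP F p] :
    Witt F p →ₗ⁅F⁆ Module.End F (SymForm F p) where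
  toFun D := formDer D
  map_add' D E := by
    have : formDer (D + E) = formDer D + formDer E :=
      formDer_ext (fun f => by simp [formDer_C]) fun i => by
        simp [formDer_X, diff, Fin.sum_univ_two]; ring
    rw [this]; rfl
  map_smul' c D := by
    have : formDer (c • D) = c • formDer D :=
      formDer_ext (fun f => by
        rw [formDer_C, Derivation.smul_apply, Derivation.smul_apply, formDer_C, C_smul]) fun i => by
        simp [formDer_X, diff, Fin.sum_univ_two, C_smul]
    rw [this]; rfl
  map_lie' {D E} := by
    have : formDer ⁅D, E⁆ = ⁅formDer D, formDer E⁆ :=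
      formDer_ext (fun f => by simp [formDer_C, Derivation.commutator_apply]) fun i => by
        simp only [← diff_gen, formDer_diff, Derivation.commutator_apply]
        simp [diff, Fin.sum_univ_two]; ring
    rw [this]; exact Derivation.commutator_coe_linear_map

theorem formDerHom_apply (D : Witt F p) (n : SymForm F p) : formDerHom F p D n = formDer D n := rfl

/-- The commutator of `D` with multiplication by `a` is multiplication by `D a`, and in
characteristic `p` the `p`-th power of `ad D` is `ad (D ^ p)`. -/
theorem pow_char_leibniz [Fact p.Prime] {A : Type*} [CommRing A] [Algebra F A]
    (D : Derivation F A A) (a b : A) :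
    ((D : Module.End F A) ^ p) (a * b) =
      a * ((D : Module.End F A) ^ p) b + b * ((D : Module.End F A) ^ p) a := by
  have key : ∀ (n : ℕ), ((LieAlgebra.ad F _ (D : Module.End F A)) ^ n)
      (LinearMap.mulLeft F a) = LinearMap.mulLeft F (((D : Module.End F A) ^ n) a) := by
    intro n
    induction n with
    | zero => simp
    | succ n ih =>
      rw [pow_succ', Module.End.mul_apply, ih, pow_succ']
      refine LinearMap.ext fun c => ?_
      simp [LieRing.of_associative_ring_bracket]
      ring
  have h := key p
  rw [ad_pow_char] at h
  have h2 := congrArg (fun T : Module.End F A => T b) h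
  simp only [LinearMap.sub_apply, Module.End.mul_apply, LinearMap.mulLeft_apply] at h2
  rw [mul_comm b, ← h2]
  ring

/-- Both sides satisfy the Leibniz rule, so it suffices to compare them on functions and on `dx`,
`dy`. This is what makes the action on forms restricted. -/
theorem formDerHom_wittP [Fact p.Prime] (D : Witt F p) :
    formDerHom F p (wittP D) = formDerHom F p D ^ p := by
  have hC : ∀ (k : ℕ) (f : TruncPoly F p), (formDerHom F p D ^ k) (C f) =
      C (((D : Module.End F (TruncPoly F p)) ^ k) f) := by
    intro k
    induction k with
    | zero => intro f; rfl
    | succ k ih =>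
      intro f
      rw [pow_succ', Module.End.mul_apply, ih, pow_succ', formDerHom_apply, formDer_C]; rfl
  have hX : ∀ (k : ℕ) (f : TruncPoly F p), (formDerHom F p D ^ k) (diff f) =
      diff (((D : Module.End F (TruncPoly F p)) ^ k) f) := by
    intro k
    induction k with
    | zero => intro f; rfl
    | succ k ih =>
      intro f
      rw [pow_succ', Module.End.mul_apply, ih, pow_succ', formDerHom_apply, formDer_diff]; rfl
  refine LinearMap.ext fun n => ?_
  have hn : ∀ i, (formDerHom F p D ^ p) (X i) = formDerHom F p (wittP D) (X i) := fun i => by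
    rw [← diff_gen, hX, formDerHom_apply, formDer_diff, wittP_apply]
  induction n using MvPolynomial.induction_on with
  | C a => rw [hC, formDerHom_apply, formDer_C, wittP_apply]
  | add f g hf hg => rw [map_add, map_add, hf, hg]
  | mul_X f i hf =>
    have h1 := pow_char_leibniz (formDer D) f (X i)
    change (formDerHom F p D ^ p) _ =
      f * (formDerHom F p D ^ p) _ + X i * (formDerHom F p D ^ p) _ at h1
    rw [h1, hn, ← hf, formDerHom_apply, formDerHom_apply, formDerHom_apply, Derivation.leibniz]
    rfl

/-- The representation of `u(L)` on symmetric forms. -/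
noncomputable def formRep (F : Type*) [Field F] (p : ℕ) [Fact p.Prime] [CharP F p] :
    RestrictedEnv F p (pmapL F p) →ₐ[F] Module.End F (SymForm F p) :=
  RestrictedEnv.lift ((formDerHom F p).comp (algL F p).incl) fun D => formDerHom_wittP D.1

end SymmetricForms

/-! ### Generation of the restricted enveloping algebra -/

section RestrictedEnveloping

variable {F : Type*} [Field F] {p : ℕ} {G : Type*} [LieRing G] [LieAlgebra F G] {pm : G → G}

theorem RestrictedEnv.lift_ι {A : Type*} [Ring A] [Algebra F A] (f : G →ₗ⁅F⁆ A)
    (hf : ∀ x, f (pm x) = f x ^ p) (x : G) :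
    RestrictedEnv.lift f hf (RestrictedEnv.ι F p pm x) = f x := by
  refine (RingQuot.liftAlgHom_mkAlgHom_apply F (UniversalEnvelopingAlgebra.lift F f) _
    (UniversalEnvelopingAlgebra.ι F x)).trans ?_
  exact UniversalEnvelopingAlgebra.lift_ι_apply F f x

theorem RestrictedEnv.adjoin_range_ι :
    Algebra.adjoin F (Set.range (RestrictedEnv.ι F p pm)) = ⊤ := by
  let q : TensorAlgebra F G →ₐ[F] RestrictedEnv F p pm :=
    (RingQuot.mkAlgHom F (PRel F p pm)).comp (UniversalEnvelopingAlgebra.mkAlgHom F G)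
  have hq : Function.Surjective q :=
    (RingQuot.mkAlgHom_surjective F _).comp (RingCon.mkₐ_surjective (α := F) _)
  rw [← AlgHom.range_eq_top] at hq
  rw [← hq, ← Algebra.map_top, ← TensorAlgebra.adjoin_range_ι, AlgHom.map_adjoin, ← Set.range_comp]
  rfl

end RestrictedEnveloping


/-! ### The simple restricted `sl_2`-modules as spaces of binary forms -/

section Sl2Modules

variable {F : Type*} [Field F]

/-- The element `f` of `sl_2(F)`. -/
def sl2F (F : Type*) [Field F] : Sl2 F :=
  ⟨!![0, 0; 1, 0], by
    change Matrix.trace (_ : Matrix (Fin 2) (Fin 2) F) = 0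
    simp [Matrix.trace_fin_two]⟩

theorem sl2_eq (a : Sl2 F) :
    a = a.1 0 1 • sl2E F + a.1 0 0 • sl2H F + a.1 1 0 • sl2F F := by
  have h : Matrix.trace a.1 = 0 := a.2
  rw [Matrix.trace_fin_two] at h
  refine Subtype.ext (Matrix.ext fun i j => ?_)
  fin_cases i <;> fin_cases j <;> simp [sl2E, sl2H, sl2F]
  linear_combination h

theorem isSl2Triple (F : Type*) [Field F] : IsSl2Triple (sl2H F) (sl2E F) (sl2F F) where
  h_ne_zero h := by
    have := congrFun (congrFun (congrArg Subtype.val h) 0) 0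
    simp [sl2H] at this
  lie_e_f := by
    refine Subtype.ext (Matrix.ext fun i j => ?_)
    rw [LieSubalgebra.coe_bracket, LieRing.of_associative_ring_bracket]
    fin_cases i <;> fin_cases j <;> simp [sl2E, sl2H, sl2F]
  lie_h_e_nsmul := by
    refine Subtype.ext (Matrix.ext fun i j => ?_)
    rw [LieSubalgebra.coe_bracket, LieRing.of_associative_ring_bracket]
    fin_cases i <;> fin_cases j <;> simp [sl2E, sl2H, one_add_one_eq_two]
  lie_h_f_nsmul := by
    refine Subtype.ext (Matrix.ext fun i j => ?_)
    rw [LieSubalgebra.coe_bracket, LieRing.of_associative_ring_bracket]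
    fin_cases i <;> fin_cases j <;> simp [sl2F, sl2H]
    ring

variable {V : Type*} [AddCommGroup V] [Module F V] [LieRingModule (Sl2 F) V]
  [LieModule F (Sl2 F) V]

/-- Stability under `h` is automatic because `h = [e, f]`. -/
theorem eq_top_of_lie_stable [LieModule.IsIrreducible F (Sl2 F) V] (W : Submodule F V)
    (he : ∀ w ∈ W, ⁅sl2E F, w⁆ ∈ W) (hf : ∀ w ∈ W, ⁅sl2F F, w⁆ ∈ W) (hW : ∃ w ∈ W, w ≠ 0) :
    W = ⊤ := by
  let U : LieSubmodule F (Sl2 F) V :=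
    { W with
      lie_mem := by
        intro a w hw
        have hw' : w ∈ W := hw
        change ⁅a, w⁆ ∈ W
        rw [sl2_eq a, ← (isSl2Triple F).lie_e_f, add_lie, add_lie, smul_lie, smul_lie, smul_lie,
          lie_lie]
        exact add_mem (add_mem (W.smul_mem _ (he w hw')) (W.smul_mem _
          (sub_mem (he _ (hf w hw')) (hf _ (he w hw'))))) (W.smul_mem _ (hf w hw')) }
  have hU : U = ⊥ ∨ U = ⊤ := eq_bot_or_eq_top U
  rcases hU with hU | hU
  · obtain ⟨w, hw, hw0⟩ := hW
    have : w ∈ U := hw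
    rw [hU] at this
    exact absurd ((LieSubmodule.mem_bot w).1 this) hw0
  · refine Submodule.eq_top_iff'.2 fun w => ?_
    have : w ∈ U := by rw [hU]; exact LieSubmodule.mem_top w
    exact this

theorem span_pow_eq_top [LieModule.IsIrreducible F (Sl2 F) V] {m : V} {μ : F}
    (P : (isSl2Triple F).HasPrimitiveVectorWith m μ) :
    Submodule.span F (Set.range fun k : ℕ => (LieModule.toEnd F (Sl2 F) V (sl2F F) ^ k) m) = ⊤ := by
  refine eq_top_of_lie_stable _ (fun w hw => ?_) (fun w hw => ?_)
    ⟨m, Submodule.subset_span ⟨0, by simp⟩, P.ne_zero⟩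
  · induction hw using Submodule.span_induction with
    | mem w hw =>
      obtain ⟨k, rfl⟩ := hw
      cases k with
      | zero => simp [P.lie_e]
      | succ k =>
        dsimp only
        rw [P.lie_e_pow_succ_toEnd_f]
        exact Submodule.smul_mem _ _ (Submodule.subset_span ⟨k, rfl⟩)
    | zero => simp
    | add v w _ _ hv hw => rw [lie_add]; exact add_mem hv hw
    | smul c w _ hw => rw [lie_smul]; exact Submodule.smul_mem _ _ hw
  · induction hw using Submodule.span_induction with
    | mem w hw =>
      obtain ⟨k, rfl⟩ := hw
      exact Submodule.subset_span ⟨k + 1, (P.lie_f_pow_toEnd_f k).symm⟩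
    | zero => simp
    | add v w _ _ hv hw => rw [lie_add]; exact add_mem hv hw
    | smul c w _ hw => rw [lie_smul]; exact Submodule.smul_mem _ _ hw

variable {p : ℕ} [Fact p.Prime] [CharP F p] {l : ℕ}

theorem toEnd_sl2F_pow (hV : IsSimpleOfHighestWeight F p V l) :
    LieModule.toEnd F (Sl2 F) V (sl2F F) ^ p = 0 := by
  rw [← hV.restricted (sl2F F) 0, map_zero]
  obtain ⟨n, hn⟩ := Nat.exists_eq_add_of_le (Fact.out : p.Prime).two_le
  have : (sl2F F).1 ^ 2 = 0 := by
    ext i j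
    fin_cases i <;> fin_cases j <;> simp [sl2F, pow_two]
  rw [hn, pow_add, this, zero_mul]
  rfl

/-- Otherwise `f ^ (l + 1) m` would be a second primitive vector, and its `f`-orbit would span `V`.
That makes `f ^ (l + 1)` surjective, although `f` is nilpotent by restrictedness. -/
theorem pow_succ_highest_eq_zero (hV : IsSimpleOfHighestWeight F p V l) {m : V}
    (P : (isSl2Triple F).HasPrimitiveVectorWith m (l : F)) :
    (LieModule.toEnd F (Sl2 F) V (sl2F F) ^ (l + 1)) m = 0 := by
  have := hV.irreducible
  set f := LieModule.toEnd F (Sl2 F) V (sl2F F) with hf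
  by_contra hne
  -- The vector is killed by `e` because `e f ^ (l + 1) m = (l + 1) (l - l) f ^ l m`.
  have P' : (isSl2Triple F).HasPrimitiveVectorWith ((f ^ (l + 1)) m)
      ((l : F) - 2 * ((l + 1 : ℕ) : F)) :=
    ⟨hne, P.lie_h_pow_toEnd_f (l + 1), by rw [P.lie_e_pow_succ_toEnd_f]; simp⟩
  have hr : LinearMap.range (f ^ (l + 1)) = ⊤ := by
    rw [eq_top_iff, ← span_pow_eq_top P', Submodule.span_le]
    rintro _ ⟨k, rfl⟩
    refine ⟨(f ^ k) m, ?_⟩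
    rw [← Module.End.mul_apply, ← pow_add, add_comm, pow_add, Module.End.mul_apply]
  have hs : Function.Surjective (f ^ (l + 1)) := LinearMap.range_eq_top.1 hr
  -- The exponent `p` is chosen so that `(f ^ (l + 1)) ^ p = (f ^ p) ^ (l + 1) = 0`.
  have hs' : Function.Surjective ((f ^ (l + 1)) ^ p) := by
    rw [Module.End.coe_pow]; exact hs.iterate p
  obtain ⟨v, hv⟩ := hs' m
  rw [← pow_mul, mul_comm, pow_mul, toEnd_sl2F_pow hV, zero_pow (by omega)] at hv
  exact P.ne_zero hv.symm

theorem natCast_ne_zero_of_lt {n : ℕ} (h0 : n ≠ 0) (hn : n < p) : (n : F) ≠ 0 := by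
  rw [Ne, CharP.cast_eq_zero_iff F p]
  exact Nat.not_dvd_of_pos_of_lt (Nat.pos_of_ne_zero h0) hn

/-- Applying `e` to `f ^ (k + 1) m` returns `(k + 1) (l - k) f ^ k m`, and neither factor vanishes
modulo `p` while `k < l < p`. -/
theorem pow_highest_ne_zero {m : V} (hl : l < p)
    (P : (isSl2Triple F).HasPrimitiveVectorWith m (l : F)) {k : ℕ} (hk : k ≤ l) :
    (LieModule.toEnd F (Sl2 F) V (sl2F F) ^ k) m ≠ 0 := by
  induction k with
  | zero => exact P.ne_zero
  | succ k ih =>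
    intro h
    have h1 := P.lie_e_pow_succ_toEnd_f k
    rw [h, lie_zero, eq_comm, smul_eq_zero, mul_eq_zero] at h1
    rcases h1 with (h1 | h1) | h1
    · exact natCast_ne_zero_of_lt (F := F) (p := p) (n := k + 1) (by omega) (by omega)
        (by exact_mod_cast h1)
    · rw [← Nat.cast_sub (by omega)] at h1
      exact natCast_ne_zero_of_lt (F := F) (p := p) (n := l - k) (by omega) (by omega) h1
    · exact ih (by omega) h1

/-- The vectors `f ^ k m`, `k ≤ l`, have weights `l - 2 k`, which are distinct because `p` is odd
and `l < p`; they span because `f ^ (l + 1) m = 0`. -/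
theorem exists_basis (hp : 3 < p) (hl : l < p) (hV : IsSimpleOfHighestWeight F p V l) :
    ∃ (m : V) (b : Module.Basis (Fin (l + 1)) F V),
      (isSl2Triple F).HasPrimitiveVectorWith m (l : F) ∧
      ∀ k, b k = (LieModule.toEnd F (Sl2 F) V (sl2F F) ^ (k : ℕ)) m := by
  have := hV.irreducible
  obtain ⟨m, hm0, hme, hmh⟩ := hV.highest
  have P : (isSl2Triple F).HasPrimitiveVectorWith m (l : F) := ⟨hm0, hmh, hme⟩
  have hli : LinearIndependent F fun k : Fin (l + 1) =>
      (LieModule.toEnd F (Sl2 F) V (sl2F F) ^ (k : ℕ)) m := by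
    refine Module.End.eigenvectors_linearIndependent' (LieModule.toEnd F (Sl2 F) V (sl2H F))
      (fun k : Fin (l + 1) => (l : F) - 2 * ((k : ℕ) : F)) ?_ _ fun k => ?_
    · intro i j hij
      have h2 : ((2 : ℕ) : F) ≠ 0 := natCast_ne_zero_of_lt (p := p) (by omega) (by omega)
      have h : ((i : ℕ) : F) = ((j : ℕ) : F) := by
        refine mul_left_cancel₀ h2 ?_
        push_cast
        linear_combination -hij
      rw [CharP.natCast_eq_natCast F p] at h
      exact Fin.ext (Nat.ModEq.eq_of_lt_of_lt h (by omega) (by omega))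
    · refine ⟨Module.End.mem_eigenspace_iff.2 (P.lie_h_pow_toEnd_f k), ?_⟩
      exact pow_highest_ne_zero hl P (by omega)
  refine ⟨m, Module.Basis.mk hli ?_, P, fun k => by rw [Module.Basis.mk_apply]⟩
  rw [← span_pow_eq_top P, Submodule.span_le]
  rintro _ ⟨k, rfl⟩
  by_cases hk : k < l + 1
  · exact Submodule.subset_span ⟨⟨k, hk⟩, rfl⟩
  · obtain ⟨j, rfl⟩ := Nat.exists_eq_add_of_le (Nat.le_of_not_lt hk)
    dsimp only
    rw [add_comm _ j, pow_add, Module.End.mul_apply, pow_succ_highest_eq_zero hV P, map_zero]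
    exact zero_mem _

/-- The action of a matrix on polynomials in two variables by derivations. -/
noncomputable def matDer (a : Matrix (Fin 2) (Fin 2) F) :
    Derivation F (MvPolynomial (Fin 2) F) (MvPolynomial (Fin 2) F) :=
  mkDerivation F fun j => ∑ i, C (a i j) * X i

theorem matDer_apply (a : Matrix (Fin 2) (Fin 2) F) (s : MvPolynomial (Fin 2) F) :
    matDer a s = ∑ j, (∑ i, C (a i j) * X i) * pderiv j s := by
  have : matDer a = ∑ j, (∑ i, C (a i j) * X i : MvPolynomial (Fin 2) F) • pderiv j := by
    refine derivation_ext fun i => ?_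
    rw [matDer, mkDerivation_X]
    fin_cases i <;> simp [Fin.sum_univ_two, pderiv_X]
  rw [this]
  simp [Fin.sum_univ_two]

theorem matDer_sl2E (s : MvPolynomial (Fin 2) F) : matDer (sl2E F).1 s = X 0 * pderiv 1 s := by
  simp [matDer_apply, sl2E]

theorem matDer_sl2F (s : MvPolynomial (Fin 2) F) : matDer (sl2F F).1 s = X 1 * pderiv 0 s := by
  simp [matDer_apply, sl2F]

theorem matDer_sl2H (s : MvPolynomial (Fin 2) F) :
    matDer (sl2H F).1 s = X 0 * pderiv 0 s - X 1 * pderiv 1 s := by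
  simp [matDer_apply, sl2H]; ring

theorem X_mul_pderiv_zero (a b : ℕ) : X 0 * pderiv 0 (X 0 ^ a * X 1 ^ b : MvPolynomial (Fin 2) F) =
    (a : MvPolynomial (Fin 2) F) * (X 0 ^ a * X 1 ^ b) := by
  cases a <;> simp [Derivation.leibniz, Derivation.leibniz_pow, pderiv_X]; ring

theorem X_mul_pderiv_one (a b : ℕ) : X 1 * pderiv 1 (X 0 ^ a * X 1 ^ b : MvPolynomial (Fin 2) F) =
    (b : MvPolynomial (Fin 2) F) * (X 0 ^ a * X 1 ^ b) := by
  cases b <;> simp [Derivation.leibniz, Derivation.leibniz_pow, pderiv_X]; ring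

theorem matDer_add (a b : Matrix (Fin 2) (Fin 2) F) (s : MvPolynomial (Fin 2) F) :
    matDer (a + b) s = matDer a s + matDer b s := by
  simp [matDer_apply, Fin.sum_univ_two]; ring

theorem matDer_smul (c : F) (a : Matrix (Fin 2) (Fin 2) F) (s : MvPolynomial (Fin 2) F) :
    matDer (c • a) s = c • matDer a s := by
  simp [matDer_apply, Fin.sum_univ_two, MvPolynomial.smul_eq_C_mul]; ring

/-- A simple module of highest weight `l` is isomorphic to the space of homogeneous polynomials
of degree `l` in two variables. -/
theorem exists_polynomial_model (hp : 3 < p) (hl : l < p)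
    (hV : IsSimpleOfHighestWeight F p V l) :
    ∃ φ : V →ₗ[F] MvPolynomial (Fin 2) F, Function.Injective φ ∧
      LinearMap.range φ = homogeneousSubmodule (Fin 2) F l ∧
      (∀ (a : Sl2 F) v, φ ⁅a, v⁆ = matDer a.1 (φ v)) ∧ (∃ m, φ m = X 0 ^ l) ∧
      FiniteDimensional F V := by
  have := hV.irreducible
  obtain ⟨m, b, P, hb⟩ := exists_basis hp hl hV
  set f := LieModule.toEnd F (Sl2 F) V (sl2F F) with hf
  -- This is `f ^ k` applied to `X 0 ^ l`, where `f = X 1 ∂_0`. The falling factorial makes it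
  -- vanish for `k > l`, which hides the truncated subtraction.
  let s : ℕ → MvPolynomial (Fin 2) F := fun k =>
    (l.descFactorial k : F) • (X 0 ^ (l - k) * X 1 ^ k)
  let φ : V →ₗ[F] MvPolynomial (Fin 2) F := b.constr F fun k => s k
  have hφ : ∀ k : ℕ, φ ((f ^ k) m) = s k := by
    intro k
    by_cases hk : k < l + 1
    · have := b.constr_basis F (fun k => s k) ⟨k, hk⟩
      rwa [hb] at this
    · obtain ⟨j, rfl⟩ := Nat.exists_eq_add_of_le (Nat.le_of_not_lt hk)
      have : s (l + 1 + j) = 0 := by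
        simp only [s]
        rw [Nat.descFactorial_of_lt (by omega)]; simp
      rw [this, add_comm _ j, pow_add, Module.End.mul_apply, pow_succ_highest_eq_zero hV P,
        map_zero, map_zero]
  have hsF : ∀ k, matDer (sl2F F).1 (s k) = s (k + 1) := by
    intro k
    simp only [s, matDer_sl2F, Derivation.leibniz, Derivation.leibniz_pow,
      pderiv_X, Nat.descFactorial_succ, smul_eq_C_mul]
    simp [Nat.sub_sub]
    ring
  have hsH : ∀ k, matDer (sl2H F).1 (s k) = ((l : F) - 2 * k) • s k := by
    intro k
    by_cases hk : k ≤ l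
    · obtain ⟨j, rfl⟩ := Nat.exists_eq_add_of_le hk
      have h2 : (C (2 : F) : MvPolynomial (Fin 2) F) = 2 := map_ofNat C 2
      simp only [s]
      rw [Derivation.map_smul, matDer_sl2H, Nat.add_sub_cancel_left, X_mul_pderiv_zero,
        X_mul_pderiv_one]
      simp only [smul_eq_C_mul, map_sub, map_mul, map_natCast, h2]
      push_cast
      ring
    · simp only [s]
      rw [Nat.descFactorial_of_lt (by omega)]; simp
  have hsE : ∀ k, matDer (sl2E F).1 (s (k + 1)) = ((k + 1 : F) * (l - k)) • s k := by
    intro k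
    by_cases hk : k ≤ l
    · obtain ⟨j, rfl⟩ := Nat.exists_eq_add_of_le hk
      simp only [s, matDer_sl2E, Derivation.leibniz, Derivation.leibniz_pow,
        pderiv_X, smul_eq_C_mul, Nat.add_sub_cancel_left, Nat.descFactorial_succ]
      cases j with
      | zero => simp
      | succ j =>
        rw [show k + (j + 1) - (k + 1) = j by omega]
        simp
        ring
    · simp only [s]
      rw [Nat.descFactorial_of_lt (by omega), Nat.descFactorial_of_lt (by omega)]; simp
  have hsE0 : matDer (sl2E F).1 (s 0) = 0 := by
    simp [s, matDer_sl2E, Derivation.leibniz_pow, pderiv_X]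
  have hequiv : ∀ (a : Sl2 F) v, φ ⁅a, v⁆ = matDer a.1 (φ v) := by
    intro a v
    have hv : v ∈ Submodule.span F (Set.range fun k : ℕ => (f ^ k) m) := by
      rw [span_pow_eq_top P]; trivial
    induction hv using Submodule.span_induction with
    | mem v hv =>
      obtain ⟨k, rfl⟩ := hv
      dsimp only
      have ha : a.1 = a.1 0 1 • (sl2E F).1 + a.1 0 0 • (sl2H F).1 + a.1 1 0 • (sl2F F).1 :=
        congrArg Subtype.val (sl2_eq a)
      rw [ha, matDer_add, matDer_add, matDer_smul, matDer_smul, matDer_smul]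
      conv_lhs => rw [sl2_eq a]
      rw [add_lie, add_lie, smul_lie, smul_lie, smul_lie, P.lie_h_pow_toEnd_f,
        P.lie_f_pow_toEnd_f, hφ, hsH, hsF, map_add, map_add, map_smul, map_smul, map_smul,
        map_smul, hφ, hφ]
      congr 3
      cases k with
      | zero => rw [pow_zero, Module.End.one_apply, P.lie_e, map_zero, hsE0]
      | succ k => rw [P.lie_e_pow_succ_toEnd_f, map_smul, hφ, hsE]
    | zero => simp
    | add v w _ _ hv hw => rw [lie_add, map_add, map_add, map_add, hv, hw]
    | smul c w _ hw => rw [lie_smul, map_smul, map_smul, hw, Derivation.map_smul]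
  have hm : φ m = X 0 ^ l := by
    have := hφ 0
    simpa [s] using this
  refine ⟨φ, ?_, ?_, hequiv, ⟨m, hm⟩, b.finiteDimensional_of_finite⟩
  -- The kernel is a submodule of a simple module that misses the highest weight vector.
  · rw [← LinearMap.ker_eq_bot]
    by_contra hk
    have htop := eq_top_of_lie_stable (LinearMap.ker φ)
      (fun w hw => by rw [LinearMap.mem_ker] at hw ⊢; rw [hequiv, hw, map_zero])
      (fun w hw => by rw [LinearMap.mem_ker] at hw ⊢; rw [hequiv, hw, map_zero])
      (Submodule.exists_mem_ne_zero_of_ne_bot hk)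
    have : m ∈ LinearMap.ker φ := htop ▸ Submodule.mem_top
    rw [LinearMap.mem_ker, hm] at this
    exact pow_ne_zero l (X_ne_zero 0) this
  · refine le_antisymm ?_ fun q hq => ?_
    · rintro _ ⟨v, rfl⟩
      have hv : v ∈ Submodule.span F (Set.range b) := by rw [b.span_eq]; trivial
      induction hv using Submodule.span_induction with
      | mem v hv =>
        obtain ⟨k, rfl⟩ := hv
        rw [hb, hφ]
        refine Submodule.smul_mem _ _ ?_
        have := ((isHomogeneous_X F (0 : Fin 2)).pow (l - k)).mul
          ((isHomogeneous_X F (1 : Fin 2)).pow k)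
        rw [mem_homogeneousSubmodule]
        convert this using 1
        omega
      | zero => simp
      | add v w _ _ hv hw => rw [map_add]; exact add_mem hv hw
      | smul c w _ hw => rw [map_smul]; exact Submodule.smul_mem _ _ hw
    · rw [q.as_sum]
      refine sum_mem fun k hk => ?_
      have hdeg : k 0 + k 1 = l := by
        have := (mem_homogeneousSubmodule l q).1 hq
        by_contra hne
        refine (mem_support_iff.1 hk) (this.coeff_eq_zero ?_)
        rwa [Finsupp.degree_eq_sum, Fin.sum_univ_two]
      have hmon : monomial k (coeff k q) = coeff k q • (X 0 ^ (l - k 1) * X 1 ^ (k 1)) := by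
        rw [monomial_eq, Finsupp.prod_fintype _ _ (by simp), Fin.prod_univ_two, smul_eq_C_mul,
          show l - k 1 = k 0 by omega]
      -- The falling factorial divides `l!`, which is prime to `p` since `l < p`; so every monomial
      -- of degree `l` is hit.
      have hne : (l.descFactorial (k 1) : F) ≠ 0 := by
        rw [Ne, CharP.cast_eq_zero_iff F p]
        intro hdvd
        have h1 := Nat.factorial_mul_descFactorial (show k 1 ≤ l by omega)
        have h2 : p ∣ l.factorial := h1 ▸ hdvd.mul_left _
        rw [(Fact.out : p.Prime).dvd_factorial] at h2
        omega
      refine ⟨(coeff k q * (l.descFactorial (k 1) : F)⁻¹) • (f ^ k 1) m, ?_⟩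
      rw [map_smul, hφ, hmon, smul_smul, mul_assoc, inv_mul_cancel₀ hne, mul_one]

end Sl2Modules


/-! ### Taylor coefficients at the origin and the top monomial -/

section TruncatedPolynomials

variable {F : Type*} [Field F] {p : ℕ} [Fact p.Prime] [CharP F p]

theorem topMon_mul_eq (f : TruncPoly F p) : topMon F p * f = aug F p f • topMon F p := by
  obtain ⟨f, rfl⟩ := toTrunc_surjective f
  induction f using MvPolynomial.induction_on with
  | C a =>
    rw [← MvPolynomial.algebraMap_eq, AlgHom.commutes, AlgHom.commutes, Algebra.smul_def, mul_comm]
    rfl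
  | add f g hf hg => rw [map_add, mul_add, hf, hg, map_add, add_smul]
  | mul_X f i hf =>
    have h := topMon_mul_gen (F := F) (p := p) i
    have h' := aug_gen (F := F) (p := p) i
    unfold gen at h h'
    rw [map_mul, map_mul, h', mul_zero, zero_smul]
    linear_combination toTrunc F p f * h

/-- Differentiate `t g = 0`, where `t = x ^ (p - 1) y ^ (p - 1)`, and use that `t` sees only the
constant term of `∂_i g`. -/
theorem partialD_topMon_mul (i : Fin 2) {g : TruncPoly F p} (hg : aug F p g = 0) :
    partialD F p i (topMon F p) * g = -(aug F p (partialD F p i g) • topMon F p) := by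
  have h := congrArg (partialD F p i) (topMon_mul_eq g)
  rw [hg, zero_smul, map_zero, Derivation.leibniz, smul_eq_mul, smul_eq_mul,
    topMon_mul_eq (partialD F p i g)] at h
  linear_combination h

/-- The iterated partial derivative `∂_x ^ a ∂_y ^ b`. -/
noncomputable def iterD (F : Type*) [Field F] (p : ℕ) [CharP F p] (a b : ℕ) :
    Module.End F (TruncPoly F p) :=
  (partialD F p 0 : Module.End F (TruncPoly F p)) ^ a *
    (partialD F p 1 : Module.End F (TruncPoly F p)) ^ b

theorem iterD_zero (f : TruncPoly F p) : iterD F p 0 0 f = f := rfl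

theorem iterD_succ_left (a b : ℕ) (f : TruncPoly F p) :
    iterD F p (a + 1) b f = iterD F p a b (partialD F p 0 f) := by
  simp only [iterD, Module.End.mul_apply, pow_succ]
  rw [← partialD_pow_comm]; rfl

theorem iterD_succ_right (a b : ℕ) (f : TruncPoly F p) :
    iterD F p a (b + 1) f = iterD F p a b (partialD F p 1 f) := by
  simp only [iterD, Module.End.mul_apply, pow_succ]; rfl

theorem partialD_zero_iterD (a b : ℕ) (f : TruncPoly F p) :
    partialD F p 0 (iterD F p a b f) = iterD F p (a + 1) b f := by
  simp only [iterD, Module.End.mul_apply, pow_succ']; rfl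

theorem partialD_one_iterD (a b : ℕ) (f : TruncPoly F p) :
    partialD F p 1 (iterD F p a b f) = iterD F p a (b + 1) f := by
  simp only [iterD, Module.End.mul_apply, pow_succ']
  rw [partialD_pow_comm]; rfl

theorem iterD_eq_zero {a b : ℕ} (h : p ≤ a ∨ p ≤ b) (f : TruncPoly F p) :
    iterD F p a b f = 0 := by
  rcases h with h | h
  · obtain ⟨k, rfl⟩ := Nat.exists_eq_add_of_le h
    rw [iterD, Module.End.mul_apply, pow_add, Module.End.mul_apply, partialD_pow_char]
  · obtain ⟨k, rfl⟩ := Nat.exists_eq_add_of_le h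
    rw [iterD, Module.End.mul_apply, pow_add, Module.End.mul_apply, partialD_pow_char, map_zero]

/-- An element whose partial derivatives both vanish is constant, hence zero if its value at the
origin is zero; this is applied to the iterated derivatives, starting from the highest. -/
theorem eq_zero_of_aug_iterD {f : TruncPoly F p} (h : ∀ a b, aug F p (iterD F p a b f) = 0) :
    f = 0 := by
  -- Descending induction on the order `a + b`: from order `2 p` on, one of the exponents is at
  -- least `p` and the derivative vanishes.
  have key : ∀ k : ℕ, ∀ a b, 2 * p ≤ a + b + k → iterD F p a b f = 0 := by
    intro k
    induction k with
    | zero => intro a b hab; exact iterD_eq_zero (by omega) f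
    | succ k ih =>
      intro a b hab
      obtain ⟨c, hc⟩ := exists_eq_algebraMap (iterD F p a b f) fun i => by
        fin_cases i
        · exact (partialD_zero_iterD a b f).trans (ih (a + 1) b (by omega))
        · exact (partialD_one_iterD a b f).trans (ih a (b + 1) (by omega))
      have h1 := h a b
      rw [hc, AlgHom.commutes] at h1
      have h2 : c = 0 := h1
      rw [hc, h2, map_zero]
  exact key (2 * p) 0 0 (by omega)

theorem iterD_monomial (a b m n : ℕ) :
    iterD F p a b (gen F p 0 ^ m * gen F p 1 ^ n) =
      ((m.descFactorial a : F) * (n.descFactorial b : F)) •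
        (gen F p 0 ^ (m - a) * gen F p 1 ^ (n - b)) := by
  have h0 : ∀ m n : ℕ, partialD F p 0 (gen F p 0 ^ m * gen F p 1 ^ n) =
      (m : F) • (gen F p 0 ^ (m - 1) * gen F p 1 ^ n) := fun m n => by
    simp [Derivation.leibniz, Derivation.leibniz_pow, partialD_gen, Algebra.smul_def]; ring
  have h1 : ∀ m n : ℕ, partialD F p 1 (gen F p 0 ^ m * gen F p 1 ^ n) =
      (n : F) • (gen F p 0 ^ m * gen F p 1 ^ (n - 1)) := fun m n => by
    simp [Derivation.leibniz, Derivation.leibniz_pow, partialD_gen, Algebra.smul_def]; ring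
  induction a with
  | zero =>
    induction b with
    | zero => simp [iterD_zero]
    | succ b ih =>
      rw [← partialD_one_iterD, ih, Derivation.map_smul, h1, smul_smul, Nat.descFactorial_succ,
        Nat.sub_sub]
      push_cast
      ring_nf
  | succ a ih =>
    rw [← partialD_zero_iterD, ih, Derivation.map_smul, h0, smul_smul, Nat.descFactorial_succ,
      Nat.sub_sub]
    push_cast
    ring_nf

theorem aug_monomial (m n : ℕ) :
    aug F p (gen F p 0 ^ m * gen F p 1 ^ n) = if m = 0 ∧ n = 0 then 1 else 0 := by
  rw [map_mul, map_pow, map_pow, aug_gen, aug_gen, zero_pow_eq, zero_pow_eq]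
  split_ifs <;> simp_all

/-- Taylor coefficients of order below `2 (p - 1)` do not see the top monomial, so they ignore the
error terms produced by `modD`. -/
theorem aug_iterD_topMon {a b : ℕ} (h : a + b < 2 * (p - 1)) :
    aug F p (iterD F p a b (topMon F p)) = 0 := by
  rw [topMon, iterD_monomial, map_smul, aug_monomial, if_neg (by omega), smul_zero]

theorem descFactorial_ne_zero {m a : ℕ} (hm : m < p) (ha : a ≤ m) :
    (m.descFactorial a : F) ≠ 0 := by
  rw [Ne, CharP.cast_eq_zero_iff F p]
  intro hdvd
  have h1 := Nat.factorial_mul_descFactorial ha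
  have h2 : p ∣ m.factorial := h1 ▸ hdvd.mul_left _
  rw [(Fact.out : p.Prime).dvd_factorial] at h2
  omega

theorem aug_iterD_monomial {a b m n : ℕ} :
    aug F p (iterD F p a b (gen F p 0 ^ m * gen F p 1 ^ n)) =
      if m = a ∧ n = b then (m.descFactorial a : F) * (n.descFactorial b : F) else 0 := by
  rw [iterD_monomial, map_smul, aug_monomial]
  split_ifs with h1 h2 h2
  · simp
  · rcases Nat.lt_or_ge m a with h | h
    · simp [Nat.descFactorial_of_lt h]
    · rw [Nat.descFactorial_of_lt (show n < b by omega)]; simp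
  · omega
  · simp

/-- The derivatives of the top monomial span `O(2;1)`. -/
theorem mem_of_iterD_topMon_mem (W : Submodule F (TruncPoly F p))
    (hW : ∀ a b, a < p → b < p → iterD F p a b (topMon F p) ∈ W) (f : TruncPoly F p) : f ∈ W := by
  obtain ⟨f, rfl⟩ := toTrunc_surjective f
  rw [f.as_sum, map_sum]
  refine sum_mem fun k _ => ?_
  have hmon : toTrunc F p (monomial k (coeff k f)) =
      coeff k f • (gen F p 0 ^ k 0 * gen F p 1 ^ k 1) := by
    rw [monomial_eq, Finsupp.prod_fintype _ _ (by simp), Fin.prod_univ_two, ← smul_eq_C_mul,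
      map_smul, map_mul, map_pow, map_pow]
    rfl
  rw [hmon]
  refine W.smul_mem _ ?_
  by_cases h : k 0 < p ∧ k 1 < p
  · have h1 := hW (p - 1 - k 0) (p - 1 - k 1) (by omega) (by omega)
    rw [topMon, iterD_monomial, show p - 1 - (p - 1 - k 0) = k 0 by omega,
      show p - 1 - (p - 1 - k 1) = k 1 by omega] at h1
    exact (W.smul_mem_iff (mul_ne_zero (descFactorial_ne_zero (by omega) (by omega))
      (descFactorial_ne_zero (by omega) (by omega)))).1 h1
  · have : gen F p 0 ^ k 0 * gen F p 1 ^ k 1 = 0 := by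
      rcases Nat.lt_or_ge (k 0) p with h' | h'
      · rw [gen_pow_of_le (n := k 1) (by omega), mul_zero]
      · rw [gen_pow_of_le h', zero_mul]
    rw [this]; exact W.zero_mem

end TruncatedPolynomials


/-! ### The action of `L` on forms: values at the origin and top forms -/

section SymmetricForms

variable {F : Type*} [Field F] {p : ℕ} [Fact p.Prime] [CharP F p]

/-- Evaluation of the coefficients of a form at the origin. -/
noncomputable def formAug (F : Type*) [Field F] (p : ℕ) [Fact p.Prime] :
    SymForm F p →ₐ[F] MvPolynomial (Fin 2) F := mapAlgHom (aug F p)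

/-- The forms with constant coefficients. -/
noncomputable def constForm (F : Type*) [Field F] (p : ℕ) :
    MvPolynomial (Fin 2) F →ₐ[F] SymForm F p := mapAlgHom (Algebra.ofId F (TruncPoly F p))

/-- The forms `x ^ (p - 1) y ^ (p - 1) s`, where `s` has constant coefficients. -/
noncomputable def topForm (F : Type*) [Field F] (p : ℕ) :
    MvPolynomial (Fin 2) F →ₗ[F] SymForm F p :=
  LinearMap.mulLeft F (C (topMon F p)) ∘ₗ (constForm F p).toLinearMap

theorem topForm_apply (s : MvPolynomial (Fin 2) F) :
    topForm F p s = C (topMon F p) * constForm F p s := rfl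

theorem coeff_formAug (n : SymForm F p) (k : Fin 2 →₀ ℕ) :
    (formAug F p n).coeff k = aug F p (n.coeff k) := coeff_map _ _ _

theorem coeff_constForm (s : MvPolynomial (Fin 2) F) (k : Fin 2 →₀ ℕ) :
    (constForm F p s).coeff k = algebraMap F _ (s.coeff k) := coeff_map _ _ _

theorem coeff_topForm (s : MvPolynomial (Fin 2) F) (k : Fin 2 →₀ ℕ) :
    (topForm F p s).coeff k = s.coeff k • topMon F p := by
  rw [topForm_apply, coeff_C_mul, coeff_constForm, Algebra.smul_def, mul_comm]

theorem formAug_C (f : TruncPoly F p) : formAug F p (C f) = C (aug F p f) := map_C _ _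

theorem formAug_X (i : Fin 2) : formAug F p (X i) = X i := map_X _ _

theorem constForm_X (i : Fin 2) : constForm F p (X i) = X i := map_X _ _

theorem formAug_constForm (s : MvPolynomial (Fin 2) F) : formAug F p (constForm F p s) = s := by
  ext k
  rw [coeff_formAug, coeff_constForm, AlgHom.commutes]; rfl

theorem pderiv_formAug (i : Fin 2) (n : SymForm F p) :
    pderiv i (formAug F p n) = formAug F p (pderiv i n) := pderiv_map

theorem formAug_isHomogeneous {n : SymForm F p} {l : ℕ} (hn : n.IsHomogeneous l) :
    (formAug F p n).IsHomogeneous l := hn.map _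

theorem constForm_isHomogeneous {s : MvPolynomial (Fin 2) F} {l : ℕ} (hs : s.IsHomogeneous l) :
    (constForm F p s).IsHomogeneous l := hs.map _

theorem C_mul_isHomogeneous {n : SymForm F p} {l : ℕ} (f : TruncPoly F p)
    (hn : n.IsHomogeneous l) : (C f * n).IsHomogeneous l := by
  have := (isHomogeneous_C (Fin 2) f).mul hn
  rwa [zero_add] at this

theorem coeffDer_isHomogeneous {n : SymForm F p} {l : ℕ} (D : Witt F p)
    (hn : n.IsHomogeneous l) : (coeffDer D n).IsHomogeneous l := by
  intro k hk
  refine hn fun h => hk ?_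
  rw [coeff_coeffDer, h, map_zero]

theorem topMon_mul_form (n : SymForm F p) : C (topMon F p) * n = topForm F p (formAug F p n) := by
  ext k
  rw [coeff_C_mul, coeff_topForm, coeff_formAug, topMon_mul_eq]

theorem partialD_topMon_mul_form (i : Fin 2) {n : SymForm F p} (hn : formAug F p n = 0) :
    C (partialD F p i (topMon F p)) * n =
      -topForm F p (formAug F p (coeffDer (partialD F p i) n)) := by
  ext k
  have h := congrArg (coeff k) hn
  rw [coeff_formAug, coeff_zero] at h
  rw [coeff_C_mul, partialD_topMon_mul i h, coeff_neg, coeff_topForm, coeff_formAug,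
    coeff_coeffDer]

theorem coeffDer_smul (f : TruncPoly F p) (D : Witt F p) (n : SymForm F p) :
    coeffDer (f • D) n = C f * coeffDer D n := by
  ext k
  rw [coeff_coeffDer, coeff_C_mul, coeff_coeffDer]; rfl

/-- The coefficients of `n` vanish at the origin, so `partialD_topMon_mul` applies to each of them:
the product involves only the first derivatives of `n` at the origin and is again a top form. -/
theorem diff_topMon_mul {n : SymForm F p} (hn : formAug F p n = 0) :
    diff (topMon F p) * n =
      -topForm F p (∑ i, X i * formAug F p (coeffDer (partialD F p i) n)) := by
  have h : ∀ i, X i * topForm F p (formAug F p (coeffDer (partialD F p i) n)) =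
      topForm F p (X i * formAug F p (coeffDer (partialD F p i) n)) := fun i => by
    rw [topForm_apply, topForm_apply, map_mul, constForm_X]; ring
  have h2 : ∀ i, C (partialD F p i (topMon F p)) * X i * n =
      -topForm F p (X i * formAug F p (coeffDer (partialD F p i) n)) := fun i => by
    rw [← h, mul_comm (C _) (X i), mul_assoc, partialD_topMon_mul_form i hn, mul_neg]
  rw [diff, Fin.sum_univ_two, Fin.sum_univ_two, add_mul, h2, h2, map_add]
  ring

/-- The element `(1 - x ^ (p - 1) y ^ (p - 1)) ∂_i` of `L`. -/
noncomputable def modD (F : Type*) [Field F] (p : ℕ) [CharP F p] (i : Fin 2) : Witt F p :=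
  (1 - topMon F p) • partialD F p i

/-- The factor `1 - t`, with `t` the top monomial, is the inverse of the density `1 + t`, because `t
^ 2 = 0`; the density times the field is thus the divergence-free field `∂_i`. -/
theorem modD_mem (i : Fin 2) : modD F p i ∈ algL F p := by
  have hu : (1 + topMon F p) * (1 - topMon F p) = 1 := by
    linear_combination -topMon_sq (F := F) (p := p)
  rw [algL_eq, mem_hamTau]
  fin_cases i <;> simp [modD, partialD_gen, hu]

/-- For `m ≠ 0` the top monomial annihilates `x_i ^ m`, so the density does not matter and the field
only has to be divergence free in the usual sense. -/
theorem pow_smul_partialD_mem {i j : Fin 2} (hij : i ≠ j) {m : ℕ} (hm : m ≠ 0) :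
    gen F p i ^ m • partialD F p j ∈ algL F p := by
  have h : (1 + topMon F p) * gen F p i ^ m = gen F p i ^ m := by
    obtain ⟨k, rfl⟩ := Nat.exists_eq_succ_of_ne_zero hm
    rw [Nat.succ_eq_add_one, pow_succ]
    linear_combination gen F p i ^ k * topMon_mul_gen (F := F) (p := p) i
  rw [algL_eq, mem_hamTau]
  have hd : partialD F p j (gen F p i ^ m) = 0 := by
    simp [Derivation.leibniz_pow, partialD_gen, hij.symm]
  fin_cases j
  · simpa [partialD_gen, h] using hd
  · simpa [partialD_gen, h] using hd

/-- On forms vanishing at the origin, `modD` is plain differentiation of the coefficients up to a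
top form. The error has two sources, `-t ∂_i` on the coefficients and `-d t` in place of `dx_i`,
where `t` is the top monomial; both give top forms. -/
theorem formDer_modD (i : Fin 2) {l : ℕ} {n : SymForm F p} (hl : l ≠ 0) (hn : n.IsHomogeneous l)
    (h0 : formAug F p n = 0) :
    ∃ s : MvPolynomial (Fin 2) F, s.IsHomogeneous l ∧
      formDer (modD F p i) n = coeffDer (partialD F p i) n + topForm F p s := by
  refine ⟨-formAug F p (coeffDer (partialD F p i) n) +
    ∑ k, X k * formAug F p (coeffDer (partialD F p k) (pderiv i n)), ?_, ?_⟩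
  · refine (formAug_isHomogeneous (coeffDer_isHomogeneous _ hn)).neg.add
      (IsHomogeneous.sum _ _ _ fun k _ => ?_)
    have := (isHomogeneous_X F k).mul
      (formAug_isHomogeneous (coeffDer_isHomogeneous (partialD F p k) (hn.pderiv (i := i))))
    rwa [Nat.add_sub_cancel' (Nat.one_le_iff_ne_zero.2 hl)] at this
  · have h1 : formAug F p (pderiv i n) = 0 := by rw [← pderiv_formAug, h0, map_zero]
    have hs : ∑ j, diff (modD F p i (gen F p j)) * pderiv j n =
        -(diff (topMon F p) * pderiv i n) := by
      fin_cases i <;>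
      simp [modD, partialD_gen, diff, Fin.sum_univ_two] <;> ring
    rw [formDer_apply, hs, diff_topMon_mul h1, modD, coeffDer_smul, C_sub, C_1, sub_mul, one_mul,
      topMon_mul_form, map_add, map_neg]
    ring

theorem formDer_pow_smul_partialD (i j : Fin 2) (m : ℕ) (n : SymForm F p) :
    formDer (gen F p i ^ m • partialD F p j) n = C (gen F p i) ^ m * coeffDer (partialD F p j) n +
      (m : SymForm F p) * C (gen F p i) ^ (m - 1) * (X i * pderiv j n) := by
  rw [formDer_apply, coeffDer_smul, C_pow]
  congr 1
  fin_cases i <;> fin_cases j <;>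
  simp [diff, partialD_gen, Fin.sum_univ_two, Derivation.leibniz_pow] <;> ring

/-- The field `x_i ^ m ∂_j` acts as `x_i ^ m ∂_j + m x_i ^ (m - 1) e`, where the first term
differentiates coefficients and `e = dx_i ∂/∂(dx_j)`. The exponents `3` and `p - 2` add up to `p +
1`, so every product containing a differentiation of coefficients has a factor `x_i ^ p = 0`. Only
`3 (p - 2) x_i ^ (p - 1) e ^ 2` survives, and `3 (p - 2) = -6`. -/
theorem formDer_formDer {i j : Fin 2} (hij : i ≠ j) (hp : 3 < p) (n : SymForm F p) :
    formDer (gen F p i ^ 3 • partialD F p j) (formDer (gen F p i ^ (p - 2) • partialD F p j) n) =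
      (-6 : F) • (C (gen F p i ^ (p - 1)) * (X i * pderiv j (X i * pderiv j n))) := by
  obtain ⟨q, rfl⟩ := Nat.exists_eq_add_of_le (show 4 ≤ p by omega)
  have hz : (C (gen F (4 + q) i) : SymForm F (4 + q)) ^ (q + 4) = 0 := by
    rw [← C_pow, add_comm, gen_pow, C_0]
  have hq : (q : SymForm F (4 + q)) + 4 = 0 := by
    have := congrArg (algebraMap F (SymForm F (4 + q))) (CharP.cast_eq_zero F (4 + q))
    rw [map_natCast, map_zero] at this
    push_cast at this
    linear_combination this
  have hd : coeffDer (partialD F (4 + q) j) (C (gen F (4 + q) i)) = 0 := by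
    rw [coeffDer_C, partialD_gen, if_neg hij.symm, C_0]
  have hX : coeffDer (partialD F (4 + q) j) (X i) = 0 := coeffDer_X _ _
  have hXi : pderiv j (X i : SymForm F (4 + q)) = 0 := pderiv_X_of_ne hij
  have h6 : (-6 : F) • (C (gen F (4 + q) i ^ (4 + q - 1)) * (X i * pderiv j (X i * pderiv j n))) =
      -6 * (C (gen F (4 + q) i ^ (4 + q - 1)) * (X i * pderiv j (X i * pderiv j n))) := by
    rw [Algebra.smul_def, map_neg, map_ofNat]
  rw [h6, formDer_pow_smul_partialD, formDer_pow_smul_partialD,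
    show 4 + q - 2 = q + 2 by omega, show 4 + q - 1 = q + 3 by omega,
    show q + 2 - 1 = q + 1 by omega]
  simp only [map_add, Derivation.leibniz, Derivation.leibniz_pow, hd, hX, hXi, smul_eq_mul,
    pderiv_C, smul_zero, mul_zero, add_zero, Derivation.map_natCast, C_pow]
  push_cast
  linear_combination (C (gen F (4 + q) i) * coeffDer (partialD F (4 + q) j)
      (coeffDer (partialD F (4 + q) j) n) +
    (q + 2) * X i * coeffDer (partialD F (4 + q) j) (pderiv j n) +
    3 * X i * pderiv j (coeffDer (partialD F (4 + q) j) n)) * hz +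
    3 * C (gen F (4 + q) i) ^ (q + 3) * X i ^ 2 * pderiv j (pderiv j n) * hq

/-- A nonzero stable space of forms has an element that does not vanish at the origin. -/
theorem exists_formAug_ne_zero {l : ℕ} (hl : l ≠ 0) (N : Submodule F (SymForm F p))
    (hN : ∀ i, ∀ n ∈ N, formDer (modD F p i) n ∈ N) (hNl : ∀ n ∈ N, n.IsHomogeneous l)
    (hne : N ≠ ⊥) : ∃ n ∈ N, formAug F p n ≠ 0 := by
  by_contra! h0
  -- If a Taylor coefficient vanishes on all of `N`, apply this to the image of `n` under `modD`:
  -- the error is a top form, invisible in this order.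
  have step : ∀ a b, a + b < 2 * (p - 1) → ∀ (i : Fin 2), ∀ n ∈ N, ∀ k,
      (∀ n ∈ N, aug F p (iterD F p a b (n.coeff k)) = 0) →
        aug F p (iterD F p a b (partialD F p i (n.coeff k))) = 0 := by
    intro a b hab i n hn k h
    obtain ⟨s, -, hs⟩ := formDer_modD i hl (hNl n hn) (h0 n hn)
    have h1 := h _ (hN i n hn)
    rw [hs, coeff_add, coeff_coeffDer, coeff_topForm, map_add, map_add, map_smul, map_smul,
      aug_iterD_topMon hab, smul_zero, add_zero] at h1
    exact h1
  have key : ∀ d a b, a + b = d → ∀ n ∈ N, ∀ k, aug F p (iterD F p a b (n.coeff k)) = 0 := by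
    intro d
    induction d with
    | zero =>
      intro a b hab n hn k
      obtain ⟨rfl, rfl⟩ : a = 0 ∧ b = 0 := by omega
      rw [iterD_zero, ← coeff_formAug, h0 n hn, coeff_zero]
    | succ d ih =>
      intro a b hab n hn k
      -- When both exponents are below `p`, the order is at most `2 (p - 1)`, so the preceding order
      -- satisfies the strict bound of `step`.
      by_cases hd : p ≤ a ∨ p ≤ b
      · rw [iterD_eq_zero hd, map_zero]
      · cases a with
        | zero =>
          cases b with
          | zero => omega
          | succ b =>
            rw [iterD_succ_right]
            exact step 0 b (by omega) 1 n hn k fun n hn => ih 0 b (by omega) n hn k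
        | succ a =>
          rw [iterD_succ_left]
          exact step a b (by omega) 0 n hn k fun n hn => ih a b (by omega) n hn k
  refine hne ((Submodule.eq_bot_iff _).2 fun n hn => ?_)
  ext k
  rw [coeff_zero]
  exact eq_zero_of_aug_iterD fun a b => key _ a b rfl n hn k

/-- A stable space of forms that contains the top forms of degree `l` contains all forms of degree
`l`. -/
theorem mem_of_topForm_mem {l : ℕ} (hl : l ≠ 0) (N : Submodule F (SymForm F p))
    (hN : ∀ i, ∀ n ∈ N, formDer (modD F p i) n ∈ N)
    (htop : ∀ s : MvPolynomial (Fin 2) F, s.IsHomogeneous l → topForm F p s ∈ N)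
    {n : SymForm F p} (hn : n.IsHomogeneous l) : n ∈ N := by
  have hconst : ∀ (g : TruncPoly F p) (s : MvPolynomial (Fin 2) F) (i : Fin 2),
      coeffDer (partialD F p i) (C g * constForm F p s) =
        C (partialD F p i g) * constForm F p s := by
    intro g s i
    ext k
    rw [coeff_coeffDer, coeff_C_mul, coeff_C_mul, coeff_constForm, mul_comm,
      mul_comm (partialD _ _ _ _),
      ← Algebra.smul_def, ← Algebra.smul_def, Derivation.map_smul]
  -- The error term of `formDer_modD` is a top form and already lies in `N`, so it can be
  -- subtracted.
  have step : ∀ (g : TruncPoly F p) (s : MvPolynomial (Fin 2) F) (i : Fin 2), s.IsHomogeneous l →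
      aug F p g = 0 → C g * constForm F p s ∈ N → C (partialD F p i g) * constForm F p s ∈ N := by
    intro g s i hs hg hmem
    obtain ⟨t, ht, h⟩ := formDer_modD i hl
      (C_mul_isHomogeneous g (constForm_isHomogeneous (p := p) hs))
      (by rw [map_mul, formAug_C, hg, C_0, zero_mul])
    rw [hconst] at h
    rw [eq_sub_of_add_eq h.symm]
    exact sub_mem (hN i _ hmem) (htop t ht)
  have key : ∀ d a b, a + b = d → a < p → b < p → ∀ s : MvPolynomial (Fin 2) F,
      s.IsHomogeneous l → C (iterD F p a b (topMon F p)) * constForm F p s ∈ N := by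
    intro d
    induction d with
    | zero =>
      intro a b hab _ _ s hs
      obtain ⟨rfl, rfl⟩ : a = 0 ∧ b = 0 := by omega
      exact htop s hs
    | succ d ih =>
      intro a b hab ha hb s hs
      cases a with
      | zero =>
        cases b with
        | zero => omega
        | succ b =>
          rw [← partialD_one_iterD]
          exact step _ s 1 hs (aug_iterD_topMon (by omega)) (ih 0 b (by omega) ha (by omega) s hs)
      | succ a =>
        rw [← partialD_zero_iterD]
        exact step _ s 0 hs (aug_iterD_topMon (by omega)) (ih a b (by omega) (by omega) hb s hs)
  rw [n.as_sum]
  refine sum_mem fun k hk => ?_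
  have hs : (monomial k (1 : F)).IsHomogeneous l := by
    refine isHomogeneous_monomial _ ?_
    by_contra hne
    exact (mem_support_iff.1 hk) (hn.coeff_eq_zero hne)
  have hmon : ∀ f : TruncPoly F p, monomial k f = C f * constForm F p (monomial k 1) := fun f => by
    ext j
    rw [coeff_C_mul, coeff_constForm, coeff_monomial, coeff_monomial]
    split_ifs <;> simp
  rw [hmon]
  refine mem_of_iterD_topMon_mem
    (N.comap ((LinearMap.mulRight F (constForm F p (monomial k 1))) ∘ₗ
      (IsScalarTower.toAlgHom F (TruncPoly F p) (SymForm F p)).toLinearMap))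
    (fun a b ha hb => ?_) (coeff k n)
  exact key _ a b rfl ha hb _ hs

/-- The Lie derivative of a form along an element of `L_(0)`, at the origin. -/
theorem formAug_formDer {D : Witt F p} (hD : ∀ i, aug F p (D (gen F p i)) = 0) (n : SymForm F p) :
    formAug F p (formDer D n) = matDer (linMat D) (formAug F p n) := by
  have h : formAug F p (coeffDer D n) = 0 := by
    ext k
    rw [coeff_formAug, coeff_coeffDer, aug_apply_eq_zero hD, coeff_zero]
  rw [formDer_apply, map_add, h, zero_add, matDer_apply]
  simp [Fin.sum_univ_two, pderiv_formAug, diff, formAug_C, formAug_X, linMat]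

/-- The derivation `D` multiplies the top monomial by minus the trace of its linear part, which is
zero in `L`; and multiplication by the top monomial retains only the value of a form at the origin.
Hence top forms carry the inflation of an `sl_2`-module. -/
theorem formDer_topForm {D : Witt F p} (hD : D ∈ algL F p)
    (hD0 : ∀ i, aug F p (D (gen F p i)) = 0) (s : MvPolynomial (Fin 2) F) :
    formDer D (topForm F p s) = topForm F p (matDer (linMat D) s) := by
  have ht : D (topMon F p) = 0 := by
    have := trace_linMat hD hD0
    rw [Matrix.trace_fin_two] at this
    rw [witt_apply, mul_comm, partialD_topMon_mul 0 (hD0 0), mul_comm,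
      partialD_topMon_mul 1 (hD0 1), ← neg_add, ← add_smul]
    change -((linMat D 0 0 + linMat D 1 1) • topMon F p) = 0
    rw [this, zero_smul, neg_zero]
  rw [topForm_apply, Derivation.leibniz, formDer_C, ht, smul_eq_mul, topMon_mul_form,
    formAug_formDer hD0, formAug_constForm]
  simp

end SymmetricForms


/-! ### The spanning half of the Poincaré-Birkhoff-Witt theorem -/

section Spanning

variable {F : Type*} [Field F] {G : Type*} [LieRing G] [LieAlgebra F G] {E : Type*}
  [AddCommGroup E] [Module F E]

/-- The span of the products of at most `k` elements of `G` applied to a subspace. -/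
def prodFiltration (θ : G →ₗ⁅F⁆ Module.End F E) (V₀ : Submodule F E) : ℕ → Submodule F E
  | 0 => V₀
  | k + 1 => prodFiltration θ V₀ k ⊔
      Submodule.span F {w | ∃ z : G, ∃ m ∈ prodFiltration θ V₀ k, w = θ z m}

variable (θ : G →ₗ⁅F⁆ Module.End F E) (V₀ : Submodule F E)

theorem prodFiltration_mono : Monotone (prodFiltration θ V₀) :=
  monotone_nat_of_le_succ fun _ => le_sup_left

variable {θ V₀}

theorem apply_mem_prodFiltration {k : ℕ} (z : G) {m : E} (hm : m ∈ prodFiltration θ V₀ k) :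
    θ z m ∈ prodFiltration θ V₀ (k + 1) :=
  Submodule.mem_sup_right (Submodule.subset_span ⟨z, m, hm, rfl⟩)

theorem pow_apply_mem_prodFiltration {k : ℕ} (z : G) {m : E} (hm : m ∈ prodFiltration θ V₀ k)
    (a : ℕ) : (θ z ^ a) m ∈ prodFiltration θ V₀ (a + k) := by
  induction a with
  | zero => simpa using hm
  | succ a ih =>
    rw [pow_succ', Module.End.mul_apply, add_right_comm]
    exact apply_mem_prodFiltration z ih

/-- Commuting `z` past `y ^ a` produces products with `[z, y]` in place of one `y` and the factor
`z` removed, hence one factor fewer than `z y ^ a`. -/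
theorem apply_pow_sub_mem {k : ℕ} (z y : G) {m : E} (hm : m ∈ prodFiltration θ V₀ k) (a : ℕ) :
    θ z ((θ y ^ a) m) - (θ y ^ a) (θ z m) ∈ prodFiltration θ V₀ (a + k) := by
  induction a with
  | zero => simp
  | succ a ih =>
    have h : θ z ((θ y ^ (a + 1)) m) - (θ y ^ (a + 1)) (θ z m) =
        θ y (θ z ((θ y ^ a) m) - (θ y ^ a) (θ z m)) + θ ⁅z, y⁆ ((θ y ^ a) m) := by
      rw [LieHom.map_lie, LieRing.of_associative_ring_bracket, pow_succ', map_sub]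
      simp only [Module.End.mul_apply, LinearMap.sub_apply]
      abel
    rw [h, add_right_comm]
    exact add_mem (apply_mem_prodFiltration _ ih)
      (apply_mem_prodFiltration _ (pow_apply_mem_prodFiltration y hm a))

/-- The easy half of the Poincaré-Birkhoff-Witt theorem for restricted induced modules. -/
theorem span_pow_mul_pow_stable {p : ℕ} (hp : 2 ≤ p) {A B A' B' : G} (hA : θ A' = θ A ^ p)
    (hB : θ B' = θ B ^ p) (G₀ : Submodule F G)
    (hG : ∀ z : G, ∃ a b : F, ∃ z₀ ∈ G₀, z = a • A + b • B + z₀)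
    (hV : ∀ z ∈ G₀, ∀ v ∈ V₀, θ z v ∈ V₀) (S : Submodule F E)
    (hS : S = Submodule.span F
      {w | ∃ a b, a < p ∧ b < p ∧ ∃ v ∈ V₀, w = (θ A ^ a) ((θ B ^ b) v)})
    (z : G) {s : E} (hs : s ∈ S) : θ z s ∈ S := by
  let T : ℕ → Submodule F E := fun k => Submodule.span F
    {w | ∃ a b, a < p ∧ b < p ∧ a + b ≤ k ∧ ∃ v ∈ V₀, w = (θ A ^ a) ((θ B ^ b) v)}
  have hTmono : ∀ k, T k ≤ T (k + 1) := fun k => Submodule.span_mono (by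
    rintro _ ⟨a, b, ha, hb, hab, h⟩
    exact ⟨a, b, ha, hb, by omega, h⟩)
  have hMT : ∀ k, prodFiltration θ V₀ k ≤ T k := by
    intro k
    induction k with
    | zero =>
      intro v hv
      exact Submodule.subset_span ⟨0, 0, by omega, by omega, le_rfl, v, hv, by simp⟩
    | succ k ih =>
      refine sup_le (ih.trans (hTmono k)) (Submodule.span_le.2 ?_)
      rintro _ ⟨z, m, hm, rfl⟩
      have hm' := ih hm
      change θ z m ∈ T (k + 1)
      clear hm
      induction hm' using Submodule.span_induction with
      | zero => simp
      | add v w _ _ hv hw => rw [map_add]; exact add_mem hv hw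
      | smul c w _ hw => rw [map_smul]; exact Submodule.smul_mem _ _ hw
      | mem m hm =>
        obtain ⟨a, b, ha, hb, hab, v, hv, rfl⟩ := hm
        have hlow : ∀ {w j}, w ∈ prodFiltration θ V₀ j → j ≤ k → w ∈ T (k + 1) := fun hw hj =>
          hTmono k (ih (prodFiltration_mono θ V₀ hj hw))
        have hv0 : v ∈ prodFiltration θ V₀ 0 := hv
        have hBv := pow_apply_mem_prodFiltration B hv0 b
        obtain ⟨c, d, z₀, hz₀, rfl⟩ := hG z
        rw [map_add, map_add, map_smul, map_smul]
        simp only [LinearMap.add_apply, LinearMap.smul_apply]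
        refine add_mem (add_mem (Submodule.smul_mem _ _ ?_) (Submodule.smul_mem _ _ ?_)) ?_
        · rw [← Module.End.mul_apply, ← pow_succ']
          by_cases h : a + 1 < p
          · exact Submodule.subset_span ⟨a + 1, b, h, hb, by omega, v, hv, rfl⟩
          -- An exponent that reaches `p` is replaced by the single factor `A'`; as `p ≥ 2`, the
          -- resulting product has at most `k` factors and the induction hypothesis applies.
          · rw [show a + 1 = p by omega, ← hA]
            exact hlow (apply_mem_prodFiltration A' hBv) (by omega)
        · have h1 := hlow (apply_pow_sub_mem B A hBv a) (by omega)
          rw [← sub_add_cancel (θ B ((θ A ^ a) ((θ B ^ b) v))) ((θ A ^ a) (θ B ((θ B ^ b) v)))]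
          refine add_mem h1 ?_
          rw [← Module.End.mul_apply (θ B), ← pow_succ']
          by_cases h : b + 1 < p
          · exact Submodule.subset_span ⟨a, b + 1, ha, h, by omega, v, hv, rfl⟩
          · rw [show b + 1 = p by omega, ← hB]
            exact hlow (pow_apply_mem_prodFiltration A (apply_mem_prodFiltration B' hv0) a)
              (by omega)
        -- An element of `G₀` is moved past both powers and absorbed by `V₀`; the two commutators
        -- have lower filtration degree.
        · have h1 := hlow (apply_pow_sub_mem z₀ A hBv a) (by omega)
          have h2 := hlow (pow_apply_mem_prodFiltration A (apply_pow_sub_mem z₀ B hv0 b) a)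
            (by omega)
          rw [map_sub] at h2
          have h3 : (θ A ^ a) ((θ B ^ b) (θ z₀ v)) ∈ T (k + 1) :=
            Submodule.subset_span ⟨a, b, ha, hb, by omega, _, hV z₀ hz₀ v hv, rfl⟩
          have h4 := add_mem (add_mem h1 h2) h3
          rwa [sub_add_sub_cancel, sub_add_cancel] at h4
  have hTS : ∀ k, T k ≤ S := fun k => hS ▸ Submodule.span_mono (by
    rintro _ ⟨a, b, ha, hb, hab, h⟩
    exact ⟨a, b, ha, hb, h⟩)
  rw [hS] at hs
  induction hs using Submodule.span_induction with
  | zero => simp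
  | add v w _ _ hv hw => rw [map_add]; exact add_mem hv hw
  | smul c w _ hw => rw [map_smul]; exact Submodule.smul_mem _ _ hw
  | mem m hm =>
    obtain ⟨a, b, ha, hb, v, hv, rfl⟩ := hm
    have hv0 : v ∈ prodFiltration θ V₀ 0 := hv
    exact hTS _ (hMT _ (apply_mem_prodFiltration z (pow_apply_mem_prodFiltration A
      (pow_apply_mem_prodFiltration B hv0 b) a)))

end Spanning

/-! ### Frobenius reciprocity and a simplicity criterion -/

section Induction

variable {F : Type*} [Field F] {A B : Type*} [Ring A] [Algebra F A] [Ring B] [Algebra F B]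
  {φ : B →ₐ[F] A} {V : Type*} [AddCommGroup V] [Module F V] {ρ : B →ₐ[F] Module.End F V}

variable (φ ρ) in
/-- The map `v ↦ 1 ⊗ v` from `V` to `A ⊗_B V`. -/
noncomputable def toInduced : V →ₗ[F] Induced φ ρ :=
  ((balancedRel φ ρ).mkQ.restrictScalars F) ∘ₗ TensorProduct.mk F A V 1

theorem smul_toInduced (a : A) (v : V) :
    a • toInduced φ ρ v = (balancedRel φ ρ).mkQ (a ⊗ₜ[F] v) := by
  change a • (balancedRel φ ρ).mkQ (1 ⊗ₜ[F] v) = _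
  rw [← map_smul, TensorProduct.smul_tmul', smul_eq_mul, mul_one]

theorem map_smul_toInduced (b : B) (v : V) :
    φ b • toInduced φ ρ v = toInduced φ ρ (ρ b v) := by
  rw [smul_toInduced, ← sub_eq_zero]
  change (balancedRel φ ρ).mkQ _ - (balancedRel φ ρ).mkQ (1 ⊗ₜ[F] ρ b v) = 0
  rw [← map_sub, Submodule.mkQ_apply, Submodule.Quotient.mk_eq_zero]
  exact Submodule.subset_span ⟨1, b, v, by rw [one_mul]⟩

theorem induced_induction {P : Induced φ ρ → Prop} (h : ∀ (a : A) v, P (a • toInduced φ ρ v))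
    (hadd : ∀ x y, P x → P y → P (x + y)) (x : Induced φ ρ) : P x := by
  obtain ⟨x, rfl⟩ := (balancedRel φ ρ).mkQ_surjective x
  induction x using TensorProduct.induction_on with
  | zero =>
    have := h 0 0
    rwa [smul_toInduced, TensorProduct.zero_tmul] at this
  | tmul a v => rw [← smul_toInduced]; exact h a v
  | add x y hx hy => rw [map_add]; exact hadd _ _ hx hy

/-- Frobenius reciprocity. -/
theorem exists_induced_hom {X : Type*} [AddCommGroup X] [Module F X] (rep : A →ₐ[F] Module.End F X)
    (κ : V →ₗ[F] X) (hκ : ∀ b v, rep (φ b) (κ v) = κ (ρ b v)) :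
    ∃ Φ : Induced φ ρ →ₗ[F] X, (∀ v, Φ (toInduced φ ρ v) = κ v) ∧
      ∀ a m, Φ (a • m) = rep a (Φ m) := by
  let g : A ⊗[F] V →ₗ[F] X := TensorProduct.lift
    ((LinearMap.lcomp F X κ) ∘ₗ rep.toLinearMap)
  have hg : ∀ a v, g (a ⊗ₜ v) = rep a (κ v) := fun a v => by simp [g]
  have hsmul : ∀ (a : A) (t : A ⊗[F] V), g (a • t) = rep a (g t) := by
    intro a t
    induction t using TensorProduct.induction_on with
    | zero => simp
    | tmul b v => rw [TensorProduct.smul_tmul', hg, hg, smul_eq_mul, map_mul]; rfl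
    | add x y hx hy => rw [smul_add, map_add, map_add, map_add, hx, hy]
  have hker : (balancedRel φ ρ).restrictScalars F ≤ LinearMap.ker g := by
    intro t ht
    have ht' : t ∈ balancedRel φ ρ := ht
    rw [LinearMap.mem_ker]
    clear ht
    induction ht' using Submodule.span_induction with
    | mem t ht =>
      obtain ⟨a, b, v, rfl⟩ := ht
      rw [map_sub, hg, hg, map_mul, ← hκ, Module.End.mul_apply, sub_self]
    | zero => simp
    | add x y _ _ hx hy => rw [map_add, hx, hy, add_zero]
    | smul a x _ hx => rw [hsmul, hx, map_zero]
  let Φ : Induced φ ρ →ₗ[F] X := (Submodule.liftQ _ g hker) ∘ₗ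
    (Submodule.Quotient.restrictScalarsEquiv F (balancedRel φ ρ)).symm.toLinearMap
  have hΦ : ∀ t, Φ ((balancedRel φ ρ).mkQ t) = g t := fun t => rfl
  have h1 : ∀ v, Φ (toInduced φ ρ v) = κ v := fun v => by
    change Φ ((balancedRel φ ρ).mkQ (1 ⊗ₜ[F] v)) = _
    rw [hΦ, hg, map_one]; rfl
  refine ⟨Φ, h1, fun a m => ?_⟩
  obtain ⟨t, rfl⟩ := (balancedRel φ ρ).mkQ_surjective m
  rw [← map_smul, hΦ, hΦ, hsmul]

/-- A criterion for the simplicity of an induced module. -/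
theorem isSimpleModule_induced {X : Type*} [AddCommGroup X] [Module F X]
    (rep : A →ₐ[F] Module.End F X) (κ : V →ₗ[F] X) (Φ : Induced φ ρ →ₗ[F] X)
    (hΦ : ∀ v, Φ (toInduced φ ρ v) = κ v) (hΦ' : ∀ a m, Φ (a • m) = rep a (Φ m))
    (hinj : Function.Injective Φ) (hκ : κ ≠ 0)
    (h : ∀ N : Submodule F X, (∀ a, ∀ n ∈ N, rep a n ∈ N) → N ≤ LinearMap.range Φ → N ≠ ⊥ →
      ∀ v, κ v ∈ N) : IsSimpleModule A (Induced φ ρ) := by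
  have hnt : Nontrivial (Induced φ ρ) := by
    by_contra hn
    rw [not_nontrivial_iff_subsingleton] at hn
    refine hκ (LinearMap.ext fun v => ?_)
    rw [← hΦ, Subsingleton.elim (toInduced φ ρ v) 0, map_zero]; rfl
  refine (isSimpleModule_iff A _).2 ⟨fun N => ?_⟩
  by_cases hN : N = ⊥
  · exact Or.inl hN
  · right
    obtain ⟨n, hn, hn0⟩ := Submodule.exists_mem_ne_zero_of_ne_bot hN
    -- The image of `N` contains every `κ v = Φ (1 ⊗ v)`; by injectivity `N` contains the generators
    -- `1 ⊗ v`.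
    have hmem : ∀ v, κ v ∈ (N.restrictScalars F).map Φ := by
      refine h _ ?_ LinearMap.map_le_range ?_
      · rintro a _ ⟨m, hm, rfl⟩
        exact ⟨a • m, N.smul_mem a hm, hΦ' a m⟩
      · intro h0
        have : Φ n ∈ (N.restrictScalars F).map Φ := ⟨n, hn, rfl⟩
        rw [h0, Submodule.mem_bot] at this
        exact hn0 (hinj (by rw [this, map_zero]))
    refine Submodule.eq_top_iff'.2 fun x => ?_
    refine induced_induction (P := fun x => x ∈ N) (fun a v => ?_)
      (fun x y hx hy => N.add_mem hx hy) x
    obtain ⟨m, hm, hmv⟩ := hmem v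
    rw [← hΦ] at hmv
    rw [← hinj hmv]
    exact N.smul_mem a hm

end Induction


/-! ### Stable subspaces of forms contain the top forms; a lower bound for the dimension -/

section SymmetricForms

variable {F : Type*} [Field F] {p : ℕ} [Fact p.Prime] [CharP F p]

theorem aug_gen_smul_partialD (i j k : Fin 2) :
    aug F p ((gen F p i ^ 1 • partialD F p j) (gen F p k)) = 0 := by
  simp [aug_gen]

theorem linMat_gen_smul_partialD (i j : Fin 2) :
    linMat (gen F p i ^ 1 • partialD F p j) = Matrix.of fun a b =>
      if a = i ∧ j = b then (1 : F) else 0 := by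
  ext a b
  simp only [linMat, Matrix.of_apply, Derivation.smul_apply, partialD_gen, pow_one, smul_eq_mul,
    mul_ite, mul_one, mul_zero]
  split_ifs <;> simp_all [partialD_gen]

theorem linMat_sl2E : linMat (gen F p 0 ^ 1 • partialD F p 1) = (sl2E F).1 := by
  rw [linMat_gen_smul_partialD]
  ext a b
  fin_cases a <;> fin_cases b <;> simp [sl2E]

theorem linMat_sl2F : linMat (gen F p 1 ^ 1 • partialD F p 0) = (sl2F F).1 := by
  rw [linMat_gen_smul_partialD]
  ext a b
  fin_cases a <;> fin_cases b <;> simp [sl2F]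

/-- This scalar decides the theorem: for `l = k + 2` it is `2 l (l - 1)`, nonzero modulo an odd `p`
when `2 ≤ l < p`. For `l = 1` the two lowerings would give zero. -/
theorem raise_lower_pow (k : ℕ) :
    (X 0 * pderiv 1 (X 0 * pderiv 1 (X 1 * pderiv 0 (X 1 * pderiv 0 (X 0 ^ (k + 2))))) :
      MvPolynomial (Fin 2) F) = (2 * (k + 2) * (k + 1) : F) • X 0 ^ (k + 2) := by
  have h2 : ∀ i : Fin 2, pderiv i (2 : MvPolynomial (Fin 2) F) = 0 := fun i =>
    Derivation.map_natCast _ 2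
  simp [Derivation.leibniz, Derivation.leibniz_pow, pderiv_X, smul_eq_C_mul, map_ofNat, h2]
  ring

/-- Every nonzero `L`-stable space of forms of degree `l ≥ 2` contains the top forms. -/
theorem topForm_mem {V : Type*} [AddCommGroup V] [Module F V] [LieRingModule (Sl2 F) V]
    [LieModule F (Sl2 F) V] [LieModule.IsIrreducible F (Sl2 F) V] (hp : 3 < p) {l : ℕ}
    (hl : 2 ≤ l) (hlp : l < p) (φ : V →ₗ[F] MvPolynomial (Fin 2) F)
    (hr : LinearMap.range φ = homogeneousSubmodule (Fin 2) F l)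
    (hφ : ∀ (a : Sl2 F) v, φ ⁅a, v⁆ = matDer a.1 (φ v)) {m : V} (hm : φ m = X 0 ^ l)
    (N : Submodule F (SymForm F p)) (hN : ∀ D ∈ algL F p, ∀ n ∈ N, formDer D n ∈ N)
    (hNl : ∀ n ∈ N, n.IsHomogeneous l) (hne : N ≠ ⊥) (v : V) : topForm F p (φ v) ∈ N := by
  have hEm : gen F p 0 ^ 1 • partialD F p 1 ∈ algL F p :=
    pow_smul_partialD_mem (by decide) one_ne_zero
  have hFm : gen F p 1 ^ 1 • partialD F p 0 ∈ algL F p :=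
    pow_smul_partialD_mem (by decide) one_ne_zero
  -- The values of `N` at the origin are stable under `x ∂_y` and `y ∂_x`, which act there as `e`
  -- and `f`, and are not all zero.
  have h1 : ((N.map (formAug F p).toLinearMap).comap φ) = ⊤ := by
    refine eq_top_of_lie_stable _ ?_ ?_ ?_
    · rintro w ⟨n, hn, hw⟩
      refine ⟨_, hN _ hEm n hn, ?_⟩
      rw [hφ, ← hw, ← linMat_sl2E (p := p)]
      exact formAug_formDer (aug_gen_smul_partialD 0 1) n
    · rintro w ⟨n, hn, hw⟩
      refine ⟨_, hN _ hFm n hn, ?_⟩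
      rw [hφ, ← hw, ← linMat_sl2F (p := p)]
      exact formAug_formDer (aug_gen_smul_partialD 1 0) n
    · obtain ⟨n, hn, hn0⟩ := exists_formAug_ne_zero (show l ≠ 0 by omega) N
        (fun i n hn => hN _ (modD_mem i) n hn) hNl hne
      obtain ⟨w, hw⟩ : formAug F p n ∈ LinearMap.range φ := by
        rw [hr]; exact formAug_isHomogeneous (hNl n hn)
      refine ⟨w, ⟨n, hn, hw.symm⟩, ?_⟩
      rintro rfl
      exact hn0 (hw.symm.trans (map_zero φ))
  obtain ⟨n, hn, hnm⟩ : m ∈ (N.map (formAug F p).toLinearMap).comap φ := h1 ▸ Submodule.mem_top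
  have hnm' : formAug F p n = X 0 ^ l := hnm.trans hm
  have hpow : ∀ {i j : Fin 2}, i ≠ j → ∀ n ∈ N,
      (-6 : F) • (C (gen F p i ^ (p - 1)) * (X i * pderiv j (X i * pderiv j n))) ∈ N := by
    intro i j hij n hn
    rw [← formDer_formDer hij hp]
    exact hN _ (pow_smul_partialD_mem hij (by omega)) _
      (hN _ (pow_smul_partialD_mem hij (by omega)) _ hn)
  have h6 : (-6 : F) ≠ 0 := by
    have h2 : ((2 : ℕ) : F) ≠ 0 := natCast_ne_zero_of_lt (p := p) (by omega) (by omega)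
    have h3 : ((3 : ℕ) : F) ≠ 0 := natCast_ne_zero_of_lt (p := p) (by omega) (by omega)
    have : (-6 : F) = -(((2 : ℕ) : F) * ((3 : ℕ) : F)) := by norm_num
    rw [this]
    exact neg_ne_zero.2 (mul_ne_zero h2 h3)
  -- The `y`-version of the operator, then the `x`-version: the factors `y ^ (p - 1)` and `x ^ (p -
  -- 1)` combine to the top monomial, after which only the value `dx ^ l` of `n` at the origin
  -- matters.
  have hmem := hpow (show (0 : Fin 2) ≠ 1 by decide) _
    ((N.smul_mem_iff h6).1 (hpow (show (1 : Fin 2) ≠ 0 by decide) n hn))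
  rw [N.smul_mem_iff h6] at hmem
  have hX0 : (pderiv 1 (X 0 : SymForm F p)) = 0 := pderiv_X_of_ne (by decide)
  have hcalc : C (gen F p 0 ^ (p - 1)) * (X 0 * pderiv 1 (X 0 * pderiv 1
      (C (gen F p 1 ^ (p - 1)) * (X 1 * pderiv 0 (X 1 * pderiv 0 n))))) =
      C (topMon F p) *
        (X 0 * pderiv 1 (X 0 * pderiv 1 (X 1 * pderiv 0 (X 1 * pderiv 0 n)))) := by
    have hc : ∀ (f : TruncPoly F p) (a : SymForm F p),
        X 0 * pderiv 1 (C f * a) = C f * (X 0 * pderiv 1 a) := fun f a => by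
      rw [pderiv_C_mul]; ring
    rw [hc, hc, topMon, C_mul]
    ring
  rw [hcalc, topMon_mul_form] at hmem
  have haug : ∀ (i j : Fin 2) (a : SymForm F p),
      formAug F p (X i * pderiv j a) = X i * pderiv j (formAug F p a) := fun i j a => by
    rw [map_mul, formAug_X, pderiv_formAug]
  rw [haug, haug, haug, haug, hnm'] at hmem
  obtain ⟨k, rfl⟩ := Nat.exists_eq_add_of_le' hl
  have hk : (2 * (k + 2) * (k + 1) : F) ≠ 0 := by
    have h2 : ((2 : ℕ) : F) ≠ 0 := natCast_ne_zero_of_lt (p := p) (by omega) (by omega)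
    have h3 : ((k + 2 : ℕ) : F) ≠ 0 := natCast_ne_zero_of_lt (p := p) (by omega) (by omega)
    have h4 : ((k + 1 : ℕ) : F) ≠ 0 := natCast_ne_zero_of_lt (p := p) (by omega) (by omega)
    have := mul_ne_zero (mul_ne_zero h2 h3) h4
    push_cast at this
    exact this
  rw [raise_lower_pow, map_smul, N.smul_mem_iff hk, ← hm] at hmem
  -- One nonzero top form suffices, because the top forms of degree `l` are an irreducible
  -- `sl_2`-module.
  have h2 : N.comap ((topForm F p) ∘ₗ φ) = ⊤ := by
    refine eq_top_of_lie_stable _ ?_ ?_ ⟨m, hmem, ?_⟩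
    · intro w hw
      have := hN _ hEm _ hw
      rw [LinearMap.comp_apply, formDer_topForm hEm (aug_gen_smul_partialD 0 1), linMat_sl2E,
        ← hφ] at this
      exact this
    · intro w hw
      have := hN _ hFm _ hw
      rw [LinearMap.comp_apply, formDer_topForm hFm (aug_gen_smul_partialD 1 0), linMat_sl2F,
        ← hφ] at this
      exact this
    · rintro rfl
      rw [map_zero] at hm
      exact pow_ne_zero (k + 2) (X_ne_zero (R := F) (0 : Fin 2)) hm.symm
  have : v ∈ N.comap ((topForm F p) ∘ₗ φ) := h2 ▸ Submodule.mem_top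
  exact this

/-- The forms with coefficients in `O(2;1)` and values in the image of `φ`. -/
theorem exists_injective_forms {V : Type*} [AddCommGroup V] [Module F V] {l : ℕ}
    (φ : V →ₗ[F] MvPolynomial (Fin 2) F) (hinj : Function.Injective φ)
    (hφ : ∀ v, (φ v).IsHomogeneous l) :
    ∃ J : (Fin p × Fin p → V) →ₗ[F] SymForm F p, Function.Injective J ∧
      ∀ c, (J c).IsHomogeneous l := by
  let J : (Fin p × Fin p → V) →ₗ[F] SymForm F p :=
    ∑ ab : Fin p × Fin p, (LinearMap.mulLeft F
      (C (gen F p 0 ^ (ab.1 : ℕ) * gen F p 1 ^ (ab.2 : ℕ)) : SymForm F p) ∘ₗ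
        (constForm F p).toLinearMap ∘ₗ φ) ∘ₗ LinearMap.proj ab
  have hJ : ∀ c, J c = ∑ ab : Fin p × Fin p,
      C (gen F p 0 ^ (ab.1 : ℕ) * gen F p 1 ^ (ab.2 : ℕ)) * constForm F p (φ (c ab)) := fun c => by
    simp [J, mul_assoc]
  refine ⟨J, ?_, fun c => ?_⟩
  · rw [injective_iff_map_eq_zero]
    intro c hc
    funext ab
    refine hinj ?_
    rw [Pi.zero_apply, map_zero]
    ext k
    -- The Taylor functional of order `ab` isolates the component `c ab`, up to a nonzero product of
    -- factorials.
    have h := congrArg (fun n => aug F p (iterD F p ab.1 ab.2 (coeff k n))) hc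
    simp only [hJ, coeff_sum, coeff_C_mul, coeff_constForm, map_sum, coeff_zero, map_zero] at h
    rw [Finset.sum_eq_single ab] at h
    · rw [mul_comm, ← Algebra.smul_def, map_smul, map_smul, aug_iterD_monomial, if_pos ⟨rfl, rfl⟩,
        smul_eq_mul] at h
      exact (mul_eq_zero.1 h).resolve_right (mul_ne_zero
        (descFactorial_ne_zero ab.1.2 le_rfl) (descFactorial_ne_zero ab.2.2 le_rfl))
    · intro ab' _ hne
      rw [mul_comm, ← Algebra.smul_def, map_smul, map_smul, aug_iterD_monomial, if_neg, smul_zero]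
      rintro ⟨h1, h2⟩
      exact hne (Prod.ext (Fin.ext h1) (Fin.ext h2))
    · intro h; exact absurd (Finset.mem_univ _) h
  · rw [hJ]
    exact IsHomogeneous.sum _ _ _ fun ab _ => C_mul_isHomogeneous _ (constForm_isHomogeneous (hφ _))

theorem formRep_ι (D : algL F p) (n : SymForm F p) :
    formRep F p (RestrictedEnv.ι F p (pmapL F p) D) n = formDer D.1 n :=
  LinearMap.congr_fun (RestrictedEnv.lift_ι ((formDerHom F p).comp (algL F p).incl) _ D) n

theorem inclEnv_ι (z : algL0 F p) : inclEnv F p (RestrictedEnv.ι F p (pmapL0 F p) z) =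
    RestrictedEnv.ι F p (pmapL F p) z.1 :=
  RestrictedEnv.lift_ι ((RestrictedEnv.ι F p (pmapL F p)).comp (algL0 F p).incl) _ z

theorem formDer_isHomogeneous {n : SymForm F p} {l : ℕ} (hl : l ≠ 0) (D : Witt F p)
    (hn : n.IsHomogeneous l) : (formDer D n).IsHomogeneous l := by
  rw [formDer_apply]
  refine (coeffDer_isHomogeneous D hn).add (IsHomogeneous.sum _ _ _ fun j _ => ?_)
  have h1 : (diff (D (gen F p j))).IsHomogeneous 1 :=
    IsHomogeneous.sum _ _ _ fun i _ => isHomogeneous_C_mul_X _ _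
  have := h1.mul (hn.pderiv (i := j))
  rwa [Nat.add_sub_cancel' (Nat.one_le_iff_ne_zero.2 hl)] at this

end SymmetricForms

/-! ### Stability and equivariance checked on the generators of `u(G)` -/

section RestrictedEnveloping

variable {F : Type*} [Field F] {p : ℕ} {G : Type*} [LieRing G] [LieAlgebra F G] {pm : G → G}

theorem RestrictedEnv.apply_mem {X : Type*} [AddCommGroup X] [Module F X]
    (rep : RestrictedEnv F p pm →ₐ[F] Module.End F X) (N : Submodule F X)
    (hN : ∀ z, ∀ n ∈ N, rep (RestrictedEnv.ι F p pm z) n ∈ N) (a : RestrictedEnv F p pm) :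
    ∀ n ∈ N, rep a n ∈ N := by
  have ha : a ∈ Algebra.adjoin F (Set.range (RestrictedEnv.ι F p pm)) := by
    rw [RestrictedEnv.adjoin_range_ι]; trivial
  induction ha using Algebra.adjoin_induction with
  | mem a ha => obtain ⟨z, rfl⟩ := ha; exact hN z
  | algebraMap c =>
    intro n hn
    rw [AlgHom.commutes]
    exact N.smul_mem c hn
  | add a b _ _ ha hb => intro n hn; rw [map_add]; exact N.add_mem (ha n hn) (hb n hn)
  | mul a b _ _ ha hb => intro n hn; rw [map_mul]; exact ha _ (hb n hn)

theorem RestrictedEnv.intertwine {X Y : Type*} [AddCommGroup X] [Module F X] [AddCommGroup Y]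
    [Module F Y] (rep : RestrictedEnv F p pm →ₐ[F] Module.End F X)
    (rep' : RestrictedEnv F p pm →ₐ[F] Module.End F Y) (κ : Y →ₗ[F] X)
    (h : ∀ z y, rep (RestrictedEnv.ι F p pm z) (κ y) = κ (rep' (RestrictedEnv.ι F p pm z) y))
    (a : RestrictedEnv F p pm) : ∀ y, rep a (κ y) = κ (rep' a y) := by
  have ha : a ∈ Algebra.adjoin F (Set.range (RestrictedEnv.ι F p pm)) := by
    rw [RestrictedEnv.adjoin_range_ι]; trivial
  induction ha using Algebra.adjoin_induction with
  | mem a ha => obtain ⟨z, rfl⟩ := ha; exact h z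
  | algebraMap c => intro y; rw [AlgHom.commutes, AlgHom.commutes]; exact (map_smul κ c y).symm
  | add a b _ _ ha hb =>
    intro y; rw [map_add, map_add, LinearMap.add_apply, ha, hb, LinearMap.add_apply, map_add]
  | mul a b _ _ ha hb =>
    intro y; rw [map_mul, map_mul, Module.End.mul_apply, hb, ha, Module.End.mul_apply]

end RestrictedEnveloping

/-! ### An upper bound for the dimension of `M(l)` -/

section Modules

variable {F : Type*} [Field F] {p : ℕ} [Fact p.Prime] [CharP F p]

/-- The top monomial vanishes at the origin, so the two fields `modD` have the values `∂_x` and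
`∂_y` there; subtracting the value of `z` at the origin leaves an element of `L_(0)`. -/
theorem algL_decomposition (z : algL F p) : ∃ a b : F, ∃ z₀ ∈ (algL0 F p).toSubmodule,
    z = a • (⟨modD F p 0, modD_mem 0⟩ : algL F p) + b • ⟨modD F p 1, modD_mem 1⟩ + z₀ := by
  have h2 : (2 : ℕ) ≤ p := two_le
  refine ⟨aug F p (z.1 (gen F p 0)), aug F p (z.1 (gen F p 1)), _, ?_,
    (add_sub_cancel _ z).symm⟩
  have htop : aug F p (topMon F p) = 0 := by
    rw [topMon, aug_monomial, if_neg (by omega)]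
  intro i
  fin_cases i <;> simp [modD, partialD_gen, htop]

variable {V : Type*} [AddCommGroup V]
  [Module F V] [LieRingModule (Sl2 F) V] [LieModule F (Sl2 F) V] {l : ℕ}

theorem inflation_ι (hV : IsSimpleOfHighestWeight F p V l) (z : algL0 F p) (v : V) :
    inflation hV (RestrictedEnv.ι F p (pmapL0 F p) z) v = ⁅linPart F p z, v⁆ :=
  LinearMap.congr_fun
    (RestrictedEnv.lift_ι ((LieModule.toEnd F (Sl2 F) V).comp (linPart F p)) _ z) v

/-- The vectors `A ^ a B ^ b ⊗ v`, `a, b < p`, span `M(l)`, where `A` and `B` span a complement of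
`L_(0)` in `L`. -/
theorem exists_surjective_indModule (hV : IsSimpleOfHighestWeight F p V l) :
    ∃ Ψ : (Fin p × Fin p → V) →ₗ[F] indModule hV, Function.Surjective Ψ := by
  let rep : RestrictedEnv F p (pmapL F p) →ₐ[F] Module.End F (indModule hV) :=
    Algebra.lsmul F F (indModule hV)
  let θ : algL F p →ₗ⁅F⁆ Module.End F (indModule hV) :=
    (AlgHom.toLieHom rep).comp (RestrictedEnv.ι F p (pmapL F p))
  let A : algL F p := ⟨modD F p 0, modD_mem 0⟩
  let B : algL F p := ⟨modD F p 1, modD_mem 1⟩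
  have hθ : ∀ z, θ (pmapL F p z) = θ z ^ p := fun z => by
    change rep (RestrictedEnv.ι F p (pmapL F p) (pmapL F p z)) = _
    rw [RestrictedEnv.ι_pm, map_pow]; rfl
  let τ := toInduced (inclEnv F p) (inflation hV)
  let Ψ : (Fin p × Fin p → V) →ₗ[F] indModule hV := ∑ ab : Fin p × Fin p,
    ((θ A ^ (ab.1 : ℕ) * θ B ^ (ab.2 : ℕ)) ∘ₗ τ) ∘ₗ LinearMap.proj ab
  have hΨ : ∀ (ab : Fin p × Fin p) v, Ψ (Pi.single ab v) =
      (θ A ^ (ab.1 : ℕ)) ((θ B ^ (ab.2 : ℕ)) (τ v)) := fun ab v => by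
    simp only [Ψ, LinearMap.sum_apply, LinearMap.comp_apply, LinearMap.proj_apply]
    rw [Finset.sum_eq_single ab]
    · simp
    · intro ab' _ hne; simp [Pi.single_eq_of_ne hne]
    · intro h; exact absurd (Finset.mem_univ _) h
  let S : Submodule F (indModule hV) := Submodule.span F
    {w | ∃ a b, a < p ∧ b < p ∧ ∃ v ∈ LinearMap.range τ, w = (θ A ^ a) ((θ B ^ b) v)}
  have hS : S ≤ LinearMap.range Ψ := by
    refine Submodule.span_le.2 ?_
    rintro _ ⟨a, b, ha, hb, _, ⟨v, rfl⟩, rfl⟩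
    exact ⟨Pi.single (⟨a, ha⟩, ⟨b, hb⟩) v, hΨ (⟨a, ha⟩, ⟨b, hb⟩) v⟩
  have hpos : 0 < p := (Fact.out : p.Prime).pos
  have hstable : ∀ z, ∀ s ∈ S, θ z s ∈ S := fun z s hs => by
    refine span_pow_mul_pow_stable (V₀ := LinearMap.range τ) (Fact.out : p.Prime).two_le (hθ A)
      (hθ B) (algL0 F p).toSubmodule algL_decomposition ?_ S rfl z hs
    rintro z hz _ ⟨v, rfl⟩
    refine ⟨inflation hV (RestrictedEnv.ι F p (pmapL0 F p) ⟨z, hz⟩) v, ?_⟩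
    rw [← map_smul_toInduced, inclEnv_ι]
    rfl
  refine ⟨Ψ, fun x => ?_⟩
  refine hS (induced_induction (P := fun x => x ∈ S) (fun a v => ?_)
    (fun x y hx hy => S.add_mem hx hy) x)
  exact RestrictedEnv.apply_mem rep S hstable a _
    (Submodule.subset_span ⟨0, 0, hpos, hpos, τ v, ⟨v, rfl⟩, by simp [τ]⟩)

end Modules

end HamTau

/-! ### Identification of `M(l)` with the forms of degree `l`, and simplicity -/

theorem mainTheorem8 {F : Type*} [Field F] [IsAlgClosed F] (p : ℕ) [Fact p.Prime] [CharP F p]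
    (hp : 3 < p) (l : ℕ) (hl : 2 ≤ l) (hl' : l ≤ p - 1) {V : Type*} [AddCommGroup V] [Module F V]
    [LieRingModule (HamTau.Sl2 F) V] [LieModule F (HamTau.Sl2 F) V]
    (hV : HamTau.IsSimpleOfHighestWeight F p V l) :
    IsSimpleModule (HamTau.RestrictedEnv F p (HamTau.pmapL F p)) (HamTau.indModule hV) := by
  open HamTau MvPolynomial in
  have := hV.irreducible
  have hlp : l < p := by omega
  have hl0 : l ≠ 0 := by omega
  obtain ⟨φ, hinj, hr, hφ, ⟨m, hm⟩, hfd⟩ := exists_polynomial_model hp hlp hV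
  have hφl : ∀ v, (φ v).IsHomogeneous l := fun v => by
    rw [← mem_homogeneousSubmodule, ← hr]; exact ⟨v, rfl⟩
  let κ : V →ₗ[F] SymForm F p := topForm F p ∘ₗ φ
  have hκl : ∀ v, (κ v).IsHomogeneous l := fun v =>
    C_mul_isHomogeneous _ (constForm_isHomogeneous (hφl v))
  have hκ : ∀ b v, formRep F p (inclEnv F p b) (κ v) = κ (inflation hV b v) := fun b =>
    RestrictedEnv.intertwine ((formRep F p).comp (inclEnv F p)) (inflation hV) κ
      (fun z v => by
        rw [AlgHom.comp_apply, inclEnv_ι, inflation_ι, formRep_ι, LinearMap.comp_apply,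
          LinearMap.comp_apply, formDer_topForm z.1.2 z.2, hφ]
        rfl) b
  obtain ⟨Φ, hΦ, hΦ'⟩ := exists_induced_hom (φ := inclEnv F p) (ρ := inflation hV)
    (formRep F p) κ hκ
  obtain ⟨Ψ, hΨ⟩ := exists_surjective_indModule hV
  let T : Submodule F (SymForm F p) :=
    (homogeneousSubmodule (Fin 2) (TruncPoly F p) l).restrictScalars F
  have hT : ∀ a, ∀ n ∈ T, formRep F p a n ∈ T := RestrictedEnv.apply_mem _ T fun z n hn => by
    rw [formRep_ι]
    exact formDer_isHomogeneous hl0 z.1 hn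
  have hΦT : ∀ x, Φ x ∈ T := induced_induction
    (fun a v => by rw [hΦ', hΦ]; exact hT a _ (hκl v))
    fun x y hx hy => by rw [map_add]; exact T.add_mem hx hy
  have hTΦ : T ≤ LinearMap.range Φ := fun n hn => by
    refine mem_of_topForm_mem hl0 (LinearMap.range Φ) ?_ ?_ hn
    · rintro i _ ⟨x, rfl⟩
      exact ⟨RestrictedEnv.ι F p (pmapL F p) ⟨modD F p i, modD_mem i⟩ • x, by
        rw [hΦ', formRep_ι]⟩
    · intro s hs
      obtain ⟨v, rfl⟩ : s ∈ LinearMap.range φ := by rw [hr]; exact hs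
      exact ⟨toInduced _ _ v, hΦ v⟩
  -- Dimension count: the image of `Φ ∘ Ψ` contains a copy, under `J`, of the source of `Ψ`, so `Φ ∘
  -- Ψ` is injective; since `Ψ` is onto, `Φ` is injective.
  have hΦinj : Function.Injective Φ := by
    obtain ⟨J, hJ, hJl⟩ := exists_injective_forms (p := p) φ hinj hφl
    have hle : LinearMap.range J ≤ LinearMap.range (Φ ∘ₗ Ψ) := by
      rintro _ ⟨c, rfl⟩
      obtain ⟨x, hx⟩ := hTΦ (hJl c)
      obtain ⟨c', rfl⟩ := hΨ x
      exact ⟨c', hx⟩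
    have h1 := Submodule.finrank_mono hle
    rw [LinearMap.finrank_range_of_inj hJ] at h1
    have h2 := LinearMap.finrank_range_add_finrank_ker (Φ ∘ₗ Ψ)
    have h3 : LinearMap.ker (Φ ∘ₗ Ψ) = ⊥ := Submodule.finrank_eq_zero.1 (by omega)
    rw [injective_iff_map_eq_zero]
    intro x hx
    obtain ⟨c, rfl⟩ := hΨ x
    have hc : c ∈ LinearMap.ker (Φ ∘ₗ Ψ) := hx
    rw [h3, Submodule.mem_bot] at hc
    rw [hc, map_zero]
  have htop : ∀ N : Submodule F (SymForm F p), (∀ a, ∀ n ∈ N, formRep F p a n ∈ N) →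
      N ≤ LinearMap.range Φ → N ≠ ⊥ → ∀ v, κ v ∈ N := fun N hN hNΦ hne v => by
    refine topForm_mem hp hl hlp φ hr hφ hm N (fun D hD n hn => ?_) (fun n hn => ?_) hne v
    · rw [← formRep_ι ⟨D, hD⟩]
      exact hN _ n hn
    · obtain ⟨x, rfl⟩ := hNΦ hn
      exact hΦT x
  refine isSimpleModule_induced (formRep F p) κ Φ hΦ hΦ' hΦinj (fun h0 => ?_) htop
  -- The map `κ` is nonzero: the coefficient of `dx ^ l` in `κ m` is the top monomial, whose Taylor
  -- coefficient of order `(p - 1, p - 1)` is the nonzero scalar `((p - 1)!) ^ 2`.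
  have h1 := congrArg (coeff (Finsupp.single 0 l)) (LinearMap.congr_fun h0 m)
  change coeff _ (topForm F p (φ m)) = 0 at h1
  rw [coeff_topForm, hm, coeff_X_pow, if_pos rfl, one_smul] at h1
  have h2 := aug_iterD_monomial (F := F) (p := p) (a := p - 1) (b := p - 1) (m := p - 1)
    (n := p - 1)
  rw [if_pos ⟨rfl, rfl⟩] at h2
  change aug F p (iterD F p _ _ (topMon F p)) = _ at h2
  rw [h1, map_zero, map_zero] at h2
  exact mul_ne_zero (descFactorial_ne_zero (p := p) (by omega) le_rfl)
    (descFactorial_ne_zero (p := p) (by omega) le_rfl) h2.symm
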